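/- \textbf{Setting.} Let $d_1,d_2\ge 1$, $T\ge 0$, let $(\Omega,\mathcal F,\{\mathcal F_t\}_{t\in[0,T]},\mathbb P)$ be a filtered probability space satisfying the usual conditions, and let $X$ and $Y$ be progressively measurable processes with values in $\mathbb R^{d_1}$ and $\mathbb R^{d_2}$ and (a.s.) deterministic initial values $X_0=x$, $Y_0=y$. Assume that $X$ satisfies $$\mathbb E\Big[\sup_{0\le t\le T}|X_t|^q\Big]\le M_q\ \ (q>0),\qquad \mathbb P\Big(\sup_{0\le t\le T}|X_t-x|\ge r\Big)\le \exp\Big(-\frac{c\,r^{\alpha}}{C_T}\Big)\ \ (r>0)$$ with constants $M_q$ and $c,C_T,\alpha>0$, and that $Y$ satisfies the same bounds around $y$ with its own constants. Write $\|f\|_{\mathcal S^2(X)}=\big(\mathbb E[\sup_{0\le t\le T}|f(X_t)|^2]\big)^{1/2}$, and similarly for $Y$. (Expectations of suprema over $t$ are upper integrals; they are the usual expectations whenever the supremum is measurable for the completed $\sigma$-algebra.) Let $\mathcal G$ be a set of functions $g:\mathbb R^{d_1}\to\mathbb R$ such that $g(X_t)$ is progressively measurable, $\|g\|_{\mathcal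 S^2(X)}<\infty$, $|g(z)|\le C_g(1+|z|^p)$ for all $z$, and $g$ is Lipschitz with constant $L_g$; here $C_g$, $p>0$ and $L_g$ are common to all $g\in\mathcal G$. Let $\mathcal U$ be a set of functions $u:\mathbb R^{d_2}\to\mathbb R$ such that $u(Y_t)$ is progressively measurable, $\|u\|_{\mathcal S^2(Y)}<\infty$, and $u$ is Lipschitz with a common constant $L_u$. \textbf{Networks.} $\mathcal F_{\rm NN}(d,1,\mathcal L,\mathfrak p,K,\kappa,R)$ is the set of functions $q:\mathbb R^d\to\mathbb R$, $$q(x)=W_{\mathcal L}\,\mathrm{ReLU}\big(W_{\mathcal L-1}\cdots \mathrm{ReLU}(W_1x+b_1)\cdots+b_{\mathcal L-1}\big)+b_{\mathcal L},$$ with $\mathcal L$ layers, hidden layers of width at most $\mathfrak p$, at most $K$ nonzero entries in all $W_l,b_l$ together, all entries bounded by $\kappa$ in absolute value, and $\sup_x|q(x)|\le R$ (no restriction on the output if $R$ is omitted). \textbf{Theorem (operator approximation).} Let $L_\Gamma,B\ge 0$. There is a constant $C>0$, depending only on $d_1,d_2,p,C_g,L_g,L_u,L_\Gamma,B$ and on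 the moment and tail constants of $X$ and $Y$, such that the following holds in every setting as above. For every $\varepsilon>0$, with $\varepsilon'=\min\{\varepsilon,\tfrac12\}$, there are integers $N_1,N_2$, classes $\mathcal F_1=\mathcal F_{\rm NN}(d_2,1,\mathcal L_1,\mathfrak p_1,K_1,\kappa_1,1)$ and $\mathcal F_2=\mathcal F_{\rm NN}(N_2,1,\mathcal L_2,\mathfrak p_2,K_2,\kappa_2)$, and points $c_1,\dots,c_{N_2}\in\mathbb R^{d_1}$ with $$N_1\le C\varepsilon'^{-d_2},\qquad N_2\le C\varepsilon'^{-d_1d_2-d_1},$$ $$\mathcal L_1\le C\log(\varepsilon'^{-2}),\quad \mathfrak p_1\le C,\quad K_1\le C\log(\varepsilon'^{-2}),\quad \kappa_1\le C\varepsilon'^{-d_2},$$ $$\mathcal L_2\le C\big(N_2^2\log N_2+N_2^2\log(\varepsilon'^{-d_2-1})\big),\qquad \mathfrak p_2\le C N_2^{1/2}\varepsilon'^{-N_2d_2-N_2},$$ $$K_2\le C N_2^{1/2}\varepsilon'^{-N_2d_2-N_2}\big(N_2^2\log N_2+N_2^2\log(\varepsilon'^{-d_2-1})\big),\qquad \kappa_2\le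 C N_2^{N_2/2}\varepsilon'^{-\frac{N_2d_2}{2}-N_2},$$ such that for every operator $\Gamma:\mathcal G\to\mathcal U$ which satisfies $$\|\Gamma(g_1)-\Gamma(g_2)\|_{\mathcal S^2(Y)}\le L_\Gamma\|g_1-g_2\|_{\mathcal S^2(X)}\quad\text{for all } g_1,g_2\in\mathcal G,$$ and $\|\Gamma(g_0)\|_{\mathcal S^2(Y)}\le B$ for at least one $g_0\in\mathcal G$, there are trunk networks $\widetilde q_1,\dots,\widetilde q_{N_1}\in\mathcal F_1$ and branch networks $\widetilde a_1,\dots,\widetilde a_{N_1}\in\mathcal F_2$ with $$\sup_{g\in\mathcal G}\mathbb E\Big[\sup_{0\le t\le T}\Big|\Gamma(g)(Y_t)-\sum_{k=1}^{N_1}\widetilde a_k\big(g(c_1),\dots,g(c_{N_2})\big)\,\widetilde q_k(Y_t)\Big|\Big]\le\varepsilon .$$ -/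

import Mathlib

open MeasureTheory Set
open scoped NNReal ENNReal

noncomputable section

/-! ### Expectations of path suprema

The supremum over an uncountable time set of a progressively measurable process is measurable with
respect to the completed `σ`-algebra only. The expectation of such a supremum is therefore written
as an upper integral, which is the usual integral of every a.e. measurable function. -/

/-- Expectation of a `[0, ∞]`-valued function: the infimum of the integrals of its measurable
majorants. -/
def expect {Ω : Type*} [MeasurableSpace Ω] (P : Measure Ω) (f : Ω → ℝ≥0∞) : ℝ≥0∞ :=
  ⨅ (g : Ω → ℝ≥0∞) (_ : Measurable g) (_ : f ≤ g), ∫⁻ ω, g ω ∂P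

/-- On a.e. measurable functions `expect` is the ordinary expectation. -/
theorem expect_eq_lintegral {Ω : Type*} [MeasurableSpace Ω] (P : Measure Ω) (f : Ω → ℝ≥0∞)
    (hf : AEMeasurable f P) : expect P f = ∫⁻ ω, f ω ∂P := by
  classical
  refine le_antisymm ?_ (le_iInf fun g => le_iInf fun _ => le_iInf fun h => lintegral_mono h)
  obtain ⟨N, hN, hNm, hN0⟩ := exists_measurable_superset_of_null (ae_iff.1 hf.ae_eq_mk)
  refine (iInf_le _ (N.piecewise (fun _ => ⊤) (hf.mk f))).trans
    ((iInf_le _ (Measurable.piecewise hNm measurable_const hf.measurable_mk)).trans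
      ((iInf_le _ ?_).trans (le_of_eq ?_)))
  · intro ω
    by_cases h : ω ∈ N
    · simp [h]
    · have h' : f ω = hf.mk f ω := by
        by_contra hne
        exact h (hN hne)
      simp [h, h']
  · refine lintegral_congr_ae ?_
    have hae : ∀ᵐ ω ∂P, ω ∉ N := by
      rw [ae_iff]
      simpa using hN0
    filter_upwards [hae, hf.ae_eq_mk] with ω h h'
    simp [h, h']

/-! ### The processes -/

/-- The filtration satisfies the usual conditions: it is right-continuous and its initial
`σ`-algebra contains all `P`-null sets. -/
structure UsualConditions {T : ℝ} (hT : 0 ≤ T) {Ω : Type*} {m : MeasurableSpace Ω}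
    (P : Measure Ω) (ℱ : Filtration (Icc (0 : ℝ) T) m) : Prop where
  rightContinuous : ℱ.IsRightContinuous
  complete : ∀ s : Set Ω, P s = 0 → MeasurableSet[ℱ ⟨0, left_mem_Icc.2 hT⟩] s

/-- `X = (X_t)_{0 ≤ t ≤ T}` is a progressively measurable `ℝ^d`-valued process started at `x`, with
`E[sup_t |X_t|^p] ≤ M p` for every `p > 0` and
`P(sup_t |X_t - x| ≥ r) ≤ exp(-c r^α / C_T)` for every `r > 0`. -/
structure IsModelProcess {T : ℝ} (hT : 0 ≤ T) {Ω : Type*} {m : MeasurableSpace Ω}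
    (P : Measure Ω) (ℱ : Filtration (Icc (0 : ℝ) T) m) {d : ℕ}
    (X : Icc (0 : ℝ) T → Ω → EuclideanSpace ℝ (Fin d)) (x : EuclideanSpace ℝ (Fin d))
    (M : ℝ → ℝ) (c CT α : ℝ) : Prop where
  progressive : IsStronglyProgressive ℱ X
  initial : ∀ᵐ ω ∂P, X ⟨0, left_mem_Icc.2 hT⟩ ω = x
  moment : ∀ p : ℝ, 0 < p →
    expect P (fun ω => ⨆ t, ENNReal.ofReal (‖X t ω‖ ^ p)) ≤ ENNReal.ofReal (M p)
  tail : ∀ r : ℝ, 0 < r →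
    P {ω | ENNReal.ofReal r ≤ ⨆ t, ENNReal.ofReal ‖X t ω - x‖}
      ≤ ENNReal.ofReal (Real.exp (-(c * r ^ α) / CT))

/-! ### Function spaces -/

/-- `‖f‖_{S²} = (E[sup_t |f(X_t)|²])^{1/2}`. -/
def s2Norm {T : ℝ} {Ω : Type*} {m : MeasurableSpace Ω} (P : Measure Ω) {d : ℕ}
    (X : Icc (0 : ℝ) T → Ω → EuclideanSpace ℝ (Fin d)) (f : EuclideanSpace ℝ (Fin d) → ℝ) :
    ℝ≥0∞ :=
  (expect P (fun ω => ⨆ t, ENNReal.ofReal (|f (X t ω)| ^ 2))) ^ (1 / 2 : ℝ)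

/-- The functions `f` for which `f(X_t)` is progressively measurable and `‖f‖_{S²} < ∞`. -/
def S2Space {T : ℝ} {Ω : Type*} {m : MeasurableSpace Ω} (P : Measure Ω)
    (ℱ : Filtration (Icc (0 : ℝ) T) m) {d : ℕ}
    (X : Icc (0 : ℝ) T → Ω → EuclideanSpace ℝ (Fin d)) :
    Set (EuclideanSpace ℝ (Fin d) → ℝ) :=
  {f | IsStronglyProgressive ℱ (fun t ω => f (X t ω)) ∧ s2Norm P X f < ⊤}

/-! ### ReLU networks -/

/-- Parameters of a feedforward ReLU network with `n` inputs and one output. `output w b` is the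
last layer `x ↦ w ⬝ x + b`; `hidden W b N` is the layer `x ↦ ReLU (W x + b)` with `k` neurons
followed by the network `N`. -/
inductive ReLUNet : ℕ → Type
  | output {n : ℕ} (w : Fin n → ℝ) (b : ℝ) : ReLUNet n
  | hidden {n k : ℕ} (W : Matrix (Fin k) (Fin n) ℝ) (b : Fin k → ℝ) (N : ReLUNet k) : ReLUNet n

namespace ReLUNet

/-- The function computed by a network. -/
def eval : {n : ℕ} → ReLUNet n → (Fin n → ℝ) → ℝ
  | _, output w b, x => w ⬝ᵥ x + b
  | _, hidden W b N, x => N.eval (fun i => max (W.mulVec x i + b i) 0)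

/-- The number of layers `L` (the number of weight matrices). -/
def depth : {n : ℕ} → ReLUNet n → ℕ
  | _, output _ _ => 1
  | _, hidden _ _ N => N.depth + 1

/-- The largest number of neurons in a hidden layer. -/
def width : {n : ℕ} → ReLUNet n → ℕ
  | _, output _ _ => 0
  | _, hidden (k := k) _ _ N => max k N.width

/-- The number of nonzero weights and biases. -/
def nnz : {n : ℕ} → ReLUNet n → ℕ
  | _, output w b => {j | w j ≠ 0}.ncard + (if b = 0 then 0 else 1)
  | _, hidden W b N => {ij : _ × _ | W ij.1 ij.2 ≠ 0}.ncard + {i | b i ≠ 0}.ncard + N.nnz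

/-- All weights and biases are at most `κ` in absolute value. -/
def ParamsLE (κ : ℝ) : {n : ℕ} → ReLUNet n → Prop
  | _, output w b => (∀ j, |w j| ≤ κ) ∧ |b| ≤ κ
  | _, hidden W b N => (∀ i j, |W i j| ≤ κ) ∧ (∀ i, |b i| ≤ κ) ∧ N.ParamsLE κ

end ReLUNet

/-- The class `F_NN(d, 1, L, 𝔭, K, κ, R)` of functions `ℝ^d → ℝ` computed by a ReLU network with `L`
layers, width at most `𝔭`, at most `K` nonzero parameters, all parameters bounded by `κ`, and output
bounded by `R`. The value `R = ⊤` means that the output is not restricted. -/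
def FNN (d L 𝔭 K : ℕ) (κ : ℝ) (R : ℝ≥0∞) : Set ((Fin d → ℝ) → ℝ) :=
  {q | ∃ N : ReLUNet d, N.eval = q ∧ N.depth = L ∧ N.width ≤ 𝔭 ∧ N.nnz ≤ K ∧ N.ParamsLE κ ∧
    ∀ x, ENNReal.ofReal |q x| ≤ R}

end

/-! At a scale `1 / n`, both sides are discretised by partitions of unity. On `ℝ^{d₂}` the trunk
networks `q k` are the nodal functions of a Kuhn triangulation with nodes `t k`, so `∑ k, u (t k) *
q k` approximates every Lipschitz `u` (`exists_trunk`, `abs_sub_sum_mul_le`). The nodes are graded: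
they fill a box of size `n`, yet their mesh near `y` is of order `(1 + |y|²) / n`. No truncation is
needed, since the weight `1 + |y|²` is paid for by moments.

The coefficients `Γ g (t k)` have to be read off samples of `g`. The sample vectors on a grid of
mesh `1 / n` in a ball of radius `n` lie in a bounded box, which is cut into `J ^ M` cells; each
occupied cell receives a representative `r j ∈ G` (`exists_cover`). With a partition of unity `ψ j`
on sample space, subordinate to small balls around these representatives, the branch network is `a k
= ∑ j, Γ (r j) (t k) * ψ j`. If `ψ j` does not vanish at the samples of `g`, then `g` and `r j` are
close on the grid, hence close up to a factor `(1 + |z|²) / n` everywhere, hence `O(1 / n)`-close in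
`S²(X)` by the fourth moment; the Lipschitz property of `Γ` transfers this to the outputs. The
approximation is thus a convex combination of interpolants of functions close to `Γ g`, with error
`O(1 / n)` (`expect_convex_combination_le`, `exists_branch`).

It remains to take `n` of order `1 / ε'`. The branch networks have four layers and size polynomial
in `J ^ M * M`, that is, a power of `1 / ε'` with exponent proportional to the number `M` of grid
points. Listing every grid point `A` times, with a constant `A`, makes `ε'^{-N₂}` with `N₂ = A * M`
large enough to bound this size (`exists_exponent`, `exists_sizes`). -/

noncomputable section

/-! ### Calculus of the upper integral: it is monotone and subadditive. -/

section Expect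

variable {Ω : Type*} [MeasurableSpace Ω] {P : Measure Ω}

theorem expect_le_lintegral {f g : Ω → ℝ≥0∞} (hg : Measurable g) (h : f ≤ g) :
    expect P f ≤ ∫⁻ ω, g ω ∂P :=
  (iInf_le _ g).trans ((iInf_le _ hg).trans (iInf_le _ h))

theorem le_expect {f : Ω → ℝ≥0∞} {a : ℝ≥0∞}
    (h : ∀ g, Measurable g → f ≤ g → a ≤ ∫⁻ ω, g ω ∂P) : a ≤ expect P f :=
  le_iInf fun g => le_iInf fun hg => le_iInf fun hfg => h g hg hfg

theorem expect_mono {f g : Ω → ℝ≥0∞} (h : f ≤ g) : expect P f ≤ expect P g :=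
  le_expect fun _ hk hgk => expect_le_lintegral hk (h.trans hgk)

theorem exists_measurable_of_expect_lt {f : Ω → ℝ≥0∞} {a : ℝ≥0∞} (h : expect P f < a) :
    ∃ g, Measurable g ∧ f ≤ g ∧ ∫⁻ ω, g ω ∂P < a := by
  simp only [expect, iInf_lt_iff] at h
  obtain ⟨g, hg, hfg, hlt⟩ := h
  exact ⟨g, hg, hfg, hlt⟩

theorem expect_add_le (f g : Ω → ℝ≥0∞) :
    expect P (fun ω => f ω + g ω) ≤ expect P f + expect P g := by
  refine ENNReal.le_of_forall_pos_le_add fun ε hε hlt => ?_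
  have hε2 : (ε / 2 : ℝ≥0∞) ≠ 0 := by simp [hε.ne']
  rw [ENNReal.add_lt_top] at hlt
  obtain ⟨f', hf', hff, hfl⟩ := exists_measurable_of_expect_lt (ENNReal.lt_add_right hlt.1.ne hε2)
  obtain ⟨g', hg', hgg, hgl⟩ := exists_measurable_of_expect_lt (ENNReal.lt_add_right hlt.2.ne hε2)
  calc expect P (fun ω => f ω + g ω) ≤ ∫⁻ ω, f' ω + g' ω ∂P :=
        expect_le_lintegral (hf'.add hg') fun ω => add_le_add (hff ω) (hgg ω)
    _ = ∫⁻ ω, f' ω ∂P + ∫⁻ ω, g' ω ∂P := lintegral_add_left hf' _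
    _ ≤ (expect P f + ε / 2) + (expect P g + ε / 2) := add_le_add hfl.le hgl.le
    _ = expect P f + expect P g + ε := by
        rw [add_add_add_comm, ENNReal.add_halves]

theorem expect_const_mul_le {c : ℝ≥0∞} (hc : c ≠ ⊤) (f : Ω → ℝ≥0∞) :
    expect P (fun ω => c * f ω) ≤ c * expect P f := by
  rcases eq_or_ne c 0 with rfl | hc0
  · simpa using expect_le_lintegral (P := P) (f := fun _ => 0) measurable_const le_rfl
  rw [mul_comm, ← ENNReal.div_le_iff hc0 hc]
  refine le_expect fun g hg hfg => ?_
  rw [ENNReal.div_le_iff hc0 hc, mul_comm, ← lintegral_const_mul c hg]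
  exact expect_le_lintegral (hg.const_mul c) fun ω => mul_le_mul_right (hfg ω) c

theorem expect_const [IsProbabilityMeasure P] (c : ℝ≥0∞) : expect P (fun _ => c) = c := by
  rw [expect_eq_lintegral P _ aemeasurable_const]
  simp

theorem expect_finset_sum_le {ι : Type*} (s : Finset ι) (f : ι → Ω → ℝ≥0∞) :
    expect P (fun ω => ∑ i ∈ s, f i ω) ≤ ∑ i ∈ s, expect P (f i) := by
  classical
  induction s using Finset.induction_on with
  | empty => simpa using expect_le_lintegral (P := P) (f := fun _ => 0) measurable_const le_rfl
  | insert a s ha ih =>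
    simp only [Finset.sum_insert ha]
    exact (expect_add_le _ _).trans (add_le_add_right ih _)

/-- Cauchy–Schwarz against the constant `1`, applied to the square root of a measurable majorant of
`F`, which is itself a measurable majorant of `f`. -/
theorem expect_le_rpow_half_expect [IsProbabilityMeasure P] {f F : Ω → ℝ≥0∞}
    (h : ∀ ω, f ω ≤ F ω ^ (1 / 2 : ℝ)) : expect P f ≤ expect P F ^ (1 / 2 : ℝ) := by
  rw [← ENNReal.rpow_le_rpow_iff (z := 2) (by norm_num), ← ENNReal.rpow_mul]
  norm_num
  refine le_expect fun G hG hFG => ?_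
  have h1 : expect P f ≤ ∫⁻ ω, G ω ^ (1 / 2 : ℝ) ∂P :=
    expect_le_lintegral (hG.pow_const _) fun ω =>
      (h ω).trans (ENNReal.rpow_le_rpow (hFG ω) (by norm_num))
  have h2 := ENNReal.lintegral_mul_le_Lp_mul_Lq P Real.HolderConjugate.two_two
    (f := fun ω => G ω ^ (1 / 2 : ℝ)) (g := fun _ => 1) (hG.pow_const _).aemeasurable
    aemeasurable_const
  simp only [Pi.mul_apply, mul_one, ← ENNReal.rpow_mul, ENNReal.one_rpow, lintegral_one,
    measure_univ] at h2
  norm_num at h2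
  calc expect P f ^ 2 ≤ ((∫⁻ ω, G ω ∂P) ^ (1 / 2 : ℝ)) ^ 2 := by
        gcongr
        exact h1.trans (by simpa using h2)
    _ = ∫⁻ ω, G ω ∂P := by
        rw [← ENNReal.rpow_natCast, ← ENNReal.rpow_mul]
        norm_num

end Expect

/-! ### Bounds for the `S²` norm from moments of the process. -/

section S2

variable {T : ℝ} {Ω : Type*} {m : MeasurableSpace Ω} {P : Measure Ω} [IsProbabilityMeasure P]
  {d : ℕ} {X : Icc (0 : ℝ) T → Ω → EuclideanSpace ℝ (Fin d)}

theorem expect_iSup_abs_le_s2Norm (f : EuclideanSpace ℝ (Fin d) → ℝ) :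
    expect P (fun ω => ⨆ t, ENNReal.ofReal |f (X t ω)|) ≤ s2Norm P X f := by
  refine expect_le_rpow_half_expect fun ω => iSup_le fun t => ?_
  calc ENNReal.ofReal |f (X t ω)| = ENNReal.ofReal (|f (X t ω)| ^ 2) ^ (1 / 2 : ℝ) := by
        rw [ENNReal.ofReal_pow (abs_nonneg _), ← ENNReal.rpow_natCast, ← ENNReal.rpow_mul]
        norm_num
    _ ≤ _ := ENNReal.rpow_le_rpow (le_iSup (fun t => ENNReal.ofReal (|f (X t ω)| ^ 2)) t)
        (by norm_num)

/-- A pathwise bound by `c (1 + |X|^k)` bounds the expected supremum by the `k`-th moment. -/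
theorem expect_iSup_le_of_growth {M c : ℝ} (hc : 0 ≤ c) (k : ℕ)
    (hM : expect P (fun ω => ⨆ t, ENNReal.ofReal (‖X t ω‖ ^ (k : ℝ))) ≤ ENNReal.ofReal M)
    {F : EuclideanSpace ℝ (Fin d) → ℝ} (hF : ∀ z, F z ≤ c * (1 + ‖z‖ ^ k)) :
    expect P (fun ω => ⨆ t, ENNReal.ofReal (F (X t ω))) ≤ ENNReal.ofReal (c * (1 + |M|)) := by
  calc expect P (fun ω => ⨆ t, ENNReal.ofReal (F (X t ω)))
      ≤ expect P (fun ω => ENNReal.ofReal c *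
          (1 + ⨆ t, ENNReal.ofReal (‖X t ω‖ ^ (k : ℝ)))) := by
        refine expect_mono fun ω => iSup_le fun t => ?_
        refine (ENNReal.ofReal_le_ofReal (hF _)).trans ?_
        rw [ENNReal.ofReal_mul hc, ENNReal.ofReal_add zero_le_one (by positivity),
          ENNReal.ofReal_one]
        gcongr
        rw [← Real.rpow_natCast]
        exact le_iSup (fun t => ENNReal.ofReal (‖X t ω‖ ^ (k : ℝ))) t
    _ ≤ ENNReal.ofReal c * (1 + ENNReal.ofReal |M|) := by
        refine (expect_const_mul_le ENNReal.ofReal_ne_top _).trans ?_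
        gcongr
        refine (expect_add_le _ _).trans ?_
        rw [expect_const]
        gcongr
        exact hM.trans (ENNReal.ofReal_le_ofReal (le_abs_self M))
    _ = ENNReal.ofReal (c * (1 + |M|)) := by
        rw [ENNReal.ofReal_mul hc, ENNReal.ofReal_add zero_le_one (abs_nonneg _),
          ENNReal.ofReal_one]

theorem s2Norm_le_of_growth {M c : ℝ} (hc : 0 ≤ c)
    (hM : expect P (fun ω => ⨆ t, ENNReal.ofReal (‖X t ω‖ ^ (4 : ℝ))) ≤ ENNReal.ofReal M)
    {f : EuclideanSpace ℝ (Fin d) → ℝ} (hf : ∀ z, |f z| ≤ c * (1 + ‖z‖ ^ 2)) :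
    s2Norm P X f ≤ ENNReal.ofReal (c * (2 * (1 + |M|))) := by
  have h : expect P (fun ω => ⨆ t, ENNReal.ofReal (|f (X t ω)| ^ 2))
      ≤ ENNReal.ofReal (2 * c ^ 2 * (1 + |M|)) := by
    refine expect_iSup_le_of_growth (F := fun z => |f z| ^ 2) (by positivity) 4
      (by exact_mod_cast hM) fun z => ?_
    calc |f z| ^ 2 ≤ (c * (1 + ‖z‖ ^ 2)) ^ 2 := by gcongr; exact hf z
      _ ≤ 2 * c ^ 2 * (1 + ‖z‖ ^ 4) := by
        nlinarith [mul_nonneg (sq_nonneg c) (sq_nonneg (1 - ‖z‖ ^ 2))]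
  calc s2Norm P X f ≤ ENNReal.ofReal (2 * c ^ 2 * (1 + |M|)) ^ (1 / 2 : ℝ) :=
        ENNReal.rpow_le_rpow h (by norm_num)
    _ ≤ ENNReal.ofReal ((c * (2 * (1 + |M|))) ^ 2) ^ (1 / 2 : ℝ) := by
        gcongr
        have := abs_nonneg M
        nlinarith [mul_nonneg (sq_nonneg c) this, mul_nonneg (sq_nonneg c) (sq_nonneg |M|)]
    _ = ENNReal.ofReal (c * (2 * (1 + |M|))) := by
        rw [ENNReal.ofReal_pow (by positivity), ← ENNReal.rpow_natCast, ← ENNReal.rpow_mul]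
        norm_num

end S2

/-! ### Building ReLU networks layer by layer. -/

section Networks

open Fintype

theorem Set.ncard_setOf_le_card {ι : Type*} [Fintype ι] (p : ι → Prop) :
    {i | p i}.ncard ≤ card ι := by
  simpa [Set.ncard_univ] using Set.ncard_le_ncard (Set.subset_univ {i | p i})

/-- `h` is the vector of activations of the `L`-th hidden layer of a ReLU network of width at most
`w` with at most `s` nonzero parameters, all bounded by `κ`: any network can be put on top. -/
def HiddenFeatures {n : ℕ} {ι : Type*} [Fintype ι] (h : (Fin n → ℝ) → ι → ℝ) (L w s : ℕ)
    (κ : ℝ) : Prop :=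
  ∀ N : ReLUNet (card ι), N.ParamsLE κ → ∃ N' : ReLUNet n,
    (∀ x, N'.eval x = N.eval fun i => h x ((equivFin ι).symm i)) ∧ N'.depth = L + N.depth ∧
      N'.width ≤ max w N.width ∧ N'.nnz ≤ s + N.nnz ∧ N'.ParamsLE κ

variable {n : ℕ} {ι ι' : Type*} [Fintype ι] [Fintype ι'] {κ : ℝ}

theorem HiddenFeatures.congr {h h' : (Fin n → ℝ) → ι → ℝ} {L w s : ℕ}
    (hh : HiddenFeatures h L w s κ) (e : ∀ x i, h' x i = h x i) : HiddenFeatures h' L w s κ := by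
  have : h' = h := funext fun x => funext fun i => e x i
  rwa [this]

theorem HiddenFeatures.mono {h : (Fin n → ℝ) → ι → ℝ} {L w s w' s' : ℕ}
    (hh : HiddenFeatures h L w s κ) (hw : w ≤ w') (hs : s ≤ s') : HiddenFeatures h L w' s' κ := by
  intro N hN
  obtain ⟨N', h1, h2, h3, h4, h5⟩ := hh N hN
  exact ⟨N', h1, h2, h3.trans (max_le_max hw le_rfl), h4.trans (by omega), h5⟩

theorem HiddenFeatures.first (W : ι → Fin n → ℝ) (b : ι → ℝ) (hW : ∀ i j, |W i j| ≤ κ)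
    (hb : ∀ i, |b i| ≤ κ) :
    HiddenFeatures (fun x i => max (∑ j, W i j * x j + b i) 0) 1 (card ι) (card ι * (n + 1)) κ := by
  intro N hN
  refine ⟨.hidden (fun i j => W ((equivFin ι).symm i) j) (fun i => b ((equivFin ι).symm i)) N,
    fun x => rfl, ?_, le_rfl, ?_, fun i j => hW _ _, fun i => hb _, hN⟩
  · simp [ReLUNet.depth, add_comm]
  · have h1 := Set.ncard_setOf_le_card (ι := Fin (card ι) × Fin n)
      (fun ij => W ((equivFin ι).symm ij.1) ij.2 ≠ 0)
    have h2 := Set.ncard_setOf_le_card (ι := Fin (card ι))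
      (fun i => b ((equivFin ι).symm i) ≠ 0)
    simp only [card_prod, card_fin] at h1 h2
    simp only [ReLUNet.nnz]
    nlinarith

/-- Features are described by what can be put on top of them, so a new layer is simply prepended to
`N` before the hypothesis is applied; networks never have to be concatenated. -/
theorem HiddenFeatures.step {h : (Fin n → ℝ) → ι → ℝ} {L w s : ℕ}
    (hh : HiddenFeatures h L w s κ) (W : ι' → ι → ℝ) (b : ι' → ℝ) (hW : ∀ i j, |W i j| ≤ κ)
    (hb : ∀ i, |b i| ≤ κ) :
    HiddenFeatures (fun x i => max (∑ j, W i j * h x j + b i) 0) (L + 1) (max w (card ι'))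
      (s + card ι' * (card ι + 1)) κ := by
  intro N hN
  obtain ⟨N', h1, h2, h3, h4, h5⟩ := hh (.hidden
    (fun i j => W ((equivFin ι').symm i) ((equivFin ι).symm j))
    (fun i => b ((equivFin ι').symm i)) N) ⟨fun i j => hW _ _, fun i => hb _, hN⟩
  refine ⟨N', fun x => ?_, ?_, ?_, ?_, h5⟩
  · rw [h1]
    simp only [ReLUNet.eval, Matrix.mulVec, dotProduct]
    congr 1
    funext i
    rw [(equivFin ι).symm.sum_comp fun j => W ((equivFin ι').symm i) j * h x j]
  · simp only [h2, ReLUNet.depth]; omega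
  · simpa only [ReLUNet.width, max_assoc] using h3
  · have h6 := Set.ncard_setOf_le_card (ι := Fin (card ι') × Fin (card ι))
      (fun ij => W ((equivFin ι').symm ij.1) ((equivFin ι).symm ij.2) ≠ 0)
    have h7 := Set.ncard_setOf_le_card (ι := Fin (card ι'))
      (fun i => b ((equivFin ι').symm i) ≠ 0)
    simp only [card_prod, card_fin] at h6 h7
    simp only [ReLUNet.nnz] at h4
    nlinarith

theorem HiddenFeatures.mem_FNN {h : (Fin n → ℝ) → ι → ℝ} {L w s : ℕ}
    (hh : HiddenFeatures h L w s κ) (v : ι → ℝ) (b : ℝ) (hv : ∀ i, |v i| ≤ κ) (hb : |b| ≤ κ)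
    {q : (Fin n → ℝ) → ℝ} (hq : ∀ x, q x = ∑ i, v i * h x i + b) {R : ℝ≥0∞}
    (hR : ∀ x, ENNReal.ofReal |q x| ≤ R) :
    q ∈ FNN n (L + 1) w (s + (card ι + 1)) κ R := by
  obtain ⟨N', h1, h2, h3, h4, h5⟩ := hh (.output (fun i => v ((equivFin ι).symm i)) b)
    ⟨fun i => hv _, hb⟩
  refine ⟨N', funext fun x => ?_, h2, by simpa [ReLUNet.width] using h3, h4.trans ?_, h5, hR⟩
  · rw [h1, hq]
    simp only [ReLUNet.eval, dotProduct]
    rw [(equivFin ι).symm.sum_comp fun j => v j * h x j]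
  · have h6 := Set.ncard_setOf_le_card (ι := Fin (card ι))
      (fun i => v ((equivFin ι).symm i) ≠ 0)
    simp only [card_fin] at h6
    simp only [ReLUNet.nnz]
    split_ifs <;> omega

/-- Two layers replace nonnegative activations `h i` by `max (h i) (h (f i))`. -/
theorem HiddenFeatures.max_comp [DecidableEq ι] {h : (Fin n → ℝ) → ι → ℝ} {L w s : ℕ}
    (hh : HiddenFeatures h L w s κ) (hκ : 1 ≤ κ) (h0 : ∀ x i, 0 ≤ h x i) (f : ι → ι) :
    HiddenFeatures (fun x i => max (h x i) (h x (f i))) (L + 2) (max w (2 * card ι))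
      (s + 2 * card ι * (card ι + 1) + card ι * (2 * card ι + 1)) κ := by
  have hone : ∀ (p : Prop) [Decidable p], |(if p then (1 : ℝ) else 0)| ≤ κ := by
    intro p _
    split_ifs
    · simpa using hκ
    · simpa using zero_le_one.trans hκ
  have h1 := hh.step (ι' := ι ⊕ ι)
    -- Based on `max a b = a + ReLU (b - a)`: the left copy passes `h i ≥ 0` through the ReLU
    -- unchanged, the right copy computes the positive part of `h (f i) - h i`, and the next layer
    -- adds them. At a fixed point of `f` the right unit gets weight zero.
    (Sum.elim (fun i j => if j = i then 1 else 0)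
      (fun i j => (if j = f i then 1 else 0) - (if f i = i then 0 else if j = i then 1 else 0)))
    (fun _ => 0)
    (by
      rintro (i | i) j
      · exact hone _
      · simp only [Sum.elim_inr]
        by_cases e1 : f i = i
        · simpa [e1] using hone (j = i)
        · by_cases e2 : j = i
          · subst e2
            simp [e1, Ne.symm e1, hκ]
          · simpa [e1, e2] using hone (j = f i))
    (fun _ => by simpa using zero_le_one.trans hκ)
  have h2 := h1.step (ι' := ι)
    (fun i => Sum.elim (fun j => if j = i then 1 else 0)
      (fun j => if j = i then (if f i = i then 0 else 1) else 0)) (fun _ => 0)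
    (by
      rintro i (j | j)
      · exact hone _
      · simp only [Sum.elim_inr]
        by_cases e1 : f i = i
        · simpa [e1] using zero_le_one.trans hκ
        · simpa [e1] using hone (j = i))
    (fun _ => by simpa using zero_le_one.trans hκ)
  refine (h2.mono ?_ ?_).congr fun x i => ?_
  · simp only [card_sum]
    omega
  · simp only [card_sum]
    exact le_of_eq (by ring)
  · simp only [Fintype.sum_sum_type, Sum.elim_inl, Sum.elim_inr, add_zero, ite_mul, one_mul,
      zero_mul, Finset.sum_ite_eq', Finset.mem_univ, if_true, sub_mul, Finset.sum_sub_distrib]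
    by_cases e1 : f i = i
    · simp [e1, h0]
    · simp only [e1, if_false, Finset.sum_ite_eq', Finset.mem_univ, if_true, max_eq_left (h0 x i)]
      rw [max_eq_left (add_nonneg (h0 x i) (le_max_right _ _)), ← max_add_add_left]
      simp [max_comm]

/-- Replace every entry `a i` of a vector by `max (a i) (a (f i))`. -/
def maxShift {ι : Type*} (f : ι → ι) (a : ι → ℝ) : ι → ℝ := fun i => max (a i) (a (f i))

theorem maxShift_iterate_nonneg {ι : Type*} {f : ι → ι} {a : ι → ℝ} (h : ∀ i, 0 ≤ a i) (m : ℕ)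
    (i : ι) : 0 ≤ (maxShift f)^[m] a i := by
  induction m generalizing i with
  | zero => exact h i
  | succ m ih =>
    rw [Function.iterate_succ_apply']
    exact (ih i).trans (le_max_left _ _)

/-- After `m` rounds the entry at `i` is the maximum of `a` over the first `m + 1` points of the
orbit of `i`. The forms with `≤` and `<` serve the closed and the open end of the interval behind
`kuhnHat`. -/
theorem maxShift_iterate_le_iff {ι : Type*} {f : ι → ι} {a : ι → ℝ} {m : ℕ} {i : ι} {c : ℝ} :
    (maxShift f)^[m] a i ≤ c ↔ ∀ r ≤ m, a (f^[r] i) ≤ c := by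
  induction m generalizing i with
  | zero => simp
  | succ m ih =>
    rw [Function.iterate_succ_apply', maxShift, max_le_iff, ih, ih]
    constructor
    · rintro ⟨h1, h2⟩ (_ | r) hr
      · exact h1 0 (Nat.zero_le _)
      · exact h2 r (by omega)
    · exact fun h => ⟨fun r hr => h r (by omega), fun r hr => h (r + 1) (by omega)⟩

theorem maxShift_iterate_lt_iff {ι : Type*} {f : ι → ι} {a : ι → ℝ} {m : ℕ} {i : ι} {c : ℝ} :
    (maxShift f)^[m] a i < c ↔ ∀ r ≤ m, a (f^[r] i) < c := by
  induction m generalizing i with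
  | zero => simp
  | succ m ih =>
    rw [Function.iterate_succ_apply', maxShift, max_lt_iff, ih, ih]
    constructor
    · rintro ⟨h1, h2⟩ (_ | r) hr
      · exact h1 0 (Nat.zero_le _)
      · exact h2 r (by omega)
    · exact fun h => ⟨fun r hr => h r (by omega), fun r hr => h (r + 1) (by omega)⟩

theorem HiddenFeatures.maxShift_iterate [DecidableEq ι] {h : (Fin n → ℝ) → ι → ℝ} {L w s : ℕ}
    (hh : HiddenFeatures h L w s κ) (hκ : 1 ≤ κ) (h0 : ∀ x i, 0 ≤ h x i) (f : ι → ι) (m : ℕ) :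
    HiddenFeatures (fun x => (maxShift f)^[m] (h x)) (L + 2 * m) (max w (2 * card ι))
      (s + m * (2 * card ι * (card ι + 1) + card ι * (2 * card ι + 1))) κ := by
  induction m with
  | zero => exact hh.mono (le_max_left _ _) (by simp)
  | succ m ih =>
    refine ((ih.max_comp hκ (fun x i => maxShift_iterate_nonneg (h0 x) m i) f).mono
      (by omega) ?_).congr fun x i => ?_
    · exact le_of_eq (by ring)
    · rw [Function.iterate_succ_apply', maxShift]

end Networks

/-! ### Threshold rounding to one-dimensional nodes, and the graded nodes. -/

section Nodes

/-- Slope of the hat function at the `k`-th of the nodes `t 0 < ⋯ < t m` to the right of the node. -/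
def slopeRight (t : ℕ → ℝ) (m k : ℕ) : ℝ := if k < m then (t (k + 1) - t k)⁻¹ else 0

/-- Slope of the hat function at the `k`-th of the nodes `t 0 < ⋯ < t m` to the left of the node. -/
def slopeLeft (t : ℕ → ℝ) (k : ℕ) : ℝ := if 0 < k then (t k - t (k - 1))⁻¹ else 0

variable {t : ℕ → ℝ} {m : ℕ}

theorem slopeRight_nonneg (ht : ∀ k < m, t k < t (k + 1)) (k : ℕ) : 0 ≤ slopeRight t m k := by
  unfold slopeRight
  split_ifs with h
  · exact inv_nonneg.2 (sub_nonneg.2 (ht k h).le)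
  · exact le_rfl

theorem slopeLeft_nonneg (ht : ∀ k < m, t k < t (k + 1)) {k : ℕ} (hk : k ≤ m) :
    0 ≤ slopeLeft t k := by
  unfold slopeLeft
  split_ifs with h
  · have := ht (k - 1) (by omega)
    rw [Nat.sub_add_cancel h] at this
    exact inv_nonneg.2 (sub_nonneg.2 this.le)
  · exact le_rfl

theorem inv_mul_max_le_iff {g u θ : ℝ} (hg : 0 < g) (hθ : 0 ≤ θ) :
    g⁻¹ * max u 0 ≤ θ ↔ u ≤ g * θ := by
  rw [inv_mul_le_iff₀ hg, max_le_iff, and_iff_left (by positivity)]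

theorem inv_mul_max_lt_iff {g u θ : ℝ} (hg : 0 < g) (hθ : 0 < θ) :
    g⁻¹ * max u 0 < θ ↔ u < g * θ := by
  rw [inv_mul_lt_iff₀ hg, max_lt_iff, and_iff_left (by positivity)]

theorem slopeLeft_mul_le_iff (ht : ∀ k < m, t k < t (k + 1)) {k : ℕ} (hk : k ≤ m) {s θ : ℝ}
    (hθ : 0 ≤ θ) : slopeLeft t k * max (t k - s) 0 ≤ θ ↔
      (0 < k → t k - s ≤ (t k - t (k - 1)) * θ) := by
  unfold slopeLeft
  split_ifs with h
  · have := ht (k - 1) (by omega)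
    rw [Nat.sub_add_cancel h] at this
    simp [inv_mul_max_le_iff (sub_pos.2 this) hθ, h]
  · simp [h, hθ]

theorem slopeRight_mul_lt_iff (ht : ∀ k < m, t k < t (k + 1)) {k : ℕ} {s θ : ℝ}
    (hθ : 0 < θ) : slopeRight t m k * max (s - t k) 0 < θ ↔
      (k < m → s - t k < (t (k + 1) - t k) * θ) := by
  unfold slopeRight
  split_ifs with h
  · simp [inv_mul_max_lt_iff (sub_pos.2 (ht k h)) hθ, h]
  · simp [h, hθ]

/-- Rounding with threshold `θ`: in a gap, `s` goes to the left end if its relative position is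
below `1 - θ` and to the right end otherwise; points beyond the extreme nodes go to these. The
selected node is the last one satisfying the left condition. -/
theorem existsUnique_node (ht : ∀ k < m, t k < t (k + 1)) {θ : ℝ} (h0 : 0 ≤ θ) (h1 : θ < 1)
    (s : ℝ) : ∃! k : Fin (m + 1), slopeLeft t k * max (t k - s) 0 ≤ θ ∧
      slopeRight t m k * max (s - t k) 0 < 1 - θ := by
  have key : ∀ k : Fin (m + 1), (slopeLeft t k * max (t k - s) 0 ≤ θ ∧
      slopeRight t m k * max (s - t k) 0 < 1 - θ) ↔
      ((0 < (k : ℕ) → t k - s ≤ (t k - t (k - 1)) * θ) ∧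
        ((k : ℕ) < m → s - t k < (t (k + 1) - t k) * (1 - θ))) := fun k => by
    rw [slopeLeft_mul_le_iff ht (Nat.lt_succ_iff.1 k.2) h0, slopeRight_mul_lt_iff ht (sub_pos.2 h1)]
  simp only [key]
  classical
  let p : ℕ → Prop := fun k => 0 < k → t k - s ≤ (t k - t (k - 1)) * θ
  have hp0 : p 0 := fun h => absurd h (lt_irrefl 0)
  have hspec : p (Nat.findGreatest p m) := Nat.findGreatest_spec (Nat.zero_le m) hp0
  have hlem : Nat.findGreatest p m ≤ m := Nat.findGreatest_le m
  have hmono : ∀ a b, a ≤ b → b ≤ m → t a ≤ t b := by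
    intro a b hab
    induction b, hab using Nat.le_induction with
    | base => exact fun _ => le_rfl
    | succ b _ ih => exact fun hb => (ih (by omega)).trans (ht b (by omega)).le
  -- For adjacent nodes the two conditions would add up to a gap smaller than itself; for nodes
  -- further apart there is even more room.
  have hlt : ∀ a b : Fin (m + 1), a < b →
      ((a : ℕ) < m → s - t a < (t (a + 1) - t a) * (1 - θ)) →
      (0 < (b : ℕ) → t b - s ≤ (t b - t (b - 1)) * θ) → False := by
    intro a b hab ha hb
    have hb' : (b : ℕ) ≤ m := Nat.lt_succ_iff.1 b.2
    have hab' : (a : ℕ) < b := hab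
    have ha2 := ha (by omega)
    have hb2 := hb (by omega)
    rcases Nat.lt_or_ge ((a : ℕ) + 1) b with h | h
    · have e1 := hmono (a + 1) (b - 1) (by omega) (by omega)
      have e2 := hmono (b - 1) b (by omega) (by omega)
      have e3 := ht a (by omega)
      nlinarith
    · have e : (b : ℕ) = a + 1 := by omega
      rw [e] at hb2
      simp only [Nat.add_sub_cancel] at hb2
      nlinarith
  refine ⟨⟨Nat.findGreatest p m, Nat.lt_succ_of_le hlem⟩, ⟨hspec, fun hk => ?_⟩, ?_⟩
  · have := Nat.findGreatest_is_greatest (P := p) (Nat.lt_succ_self _) hk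
    simp only [p, not_forall, not_le] at this
    obtain ⟨_, h⟩ := this
    simp only
    simp only [Nat.succ_eq_add_one, Nat.add_sub_cancel] at h
    linarith
  · rintro k ⟨hk1, hk2⟩
    rcases lt_trichotomy k ⟨Nat.findGreatest p m, Nat.lt_succ_of_le hlem⟩ with h | h | h
    · exact (hlt _ _ h hk2 hspec).elim
    · exact h
    · have hk : p k := hk1
      exact absurd (Nat.le_findGreatest (Nat.lt_succ_iff.1 k.2) hk)
        (not_le.2 (Fin.lt_def.1 h))

/-- Nodes `i / (n + 1 - |i|)`, `i = k - n`, `0 ≤ k ≤ 2n`: a partition of `[-n, n]` whose mesh near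
`s` is of order `(1 + s²) / n`. -/
def node (n k : ℕ) : ℝ := ((k : ℝ) - n) / (n + 1 - |(k : ℝ) - n|)

theorem node_symm {n k : ℕ} (hk : k ≤ 2 * n) : node n (2 * n - k) = -node n k := by
  have h : ((2 * n - k : ℕ) : ℝ) - n = -((k : ℝ) - n) := by
    rw [Nat.cast_sub hk]; push_cast; ring
  rw [node, h, abs_neg, neg_div, node]

theorem node_add (n i : ℕ) : node n (n + i) = i / (n + 1 - i) := by
  simp [node]

theorem node_add_gap {n i : ℕ} (hi : i < n) :
    node n (n + i + 1) - node n (n + i) = (n + 1) / ((n - i) * (n + 1 - i)) := by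
  have h : (i : ℝ) + 1 ≤ n := by exact_mod_cast hi
  have h1 : (n : ℝ) - i ≠ 0 := by linarith
  have h2 : (n : ℝ) + 1 - i ≠ 0 := by linarith
  have h3 : (n : ℝ) + 1 - (i + 1) ≠ 0 := by linarith
  rw [add_assoc, node_add, node_add]
  push_cast
  field_simp
  ring

/-- The lower bound keeps the hat slopes, which become network weights, below `n + 1`; the upper
bound is the local resolution. It holds since `1 + node n (n + i) = (n + 1) / (n + 1 - i)` and `n +
1 - i ≤ 2 * (n - i)`. -/
theorem node_add_gap_bounds {n i : ℕ} (hi : i < n) :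
    ((n : ℝ) + 1)⁻¹ ≤ node n (n + i + 1) - node n (n + i) ∧
      node n (n + i + 1) - node n (n + i) ≤ 2 * (1 + node n (n + i)) ^ 2 / (n + 1) := by
  have h : (i : ℝ) + 1 ≤ n := by exact_mod_cast hi
  have hi0 : (0 : ℝ) ≤ i := Nat.cast_nonneg i
  have h1 : (0 : ℝ) < n - i := by linarith
  have h2 : (0 : ℝ) < (n : ℝ) + 1 - i := by linarith
  rw [node_add_gap hi, node_add]
  constructor
  · rw [inv_le_iff_one_le_mul₀ (by positivity), div_mul_eq_mul_div, le_div_iff₀ (by positivity)]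
    nlinarith
  · have e : (1 + (i : ℝ) / (n + 1 - i)) = (n + 1) / (n + 1 - i) := by
      field_simp
      ring
    rw [e, div_pow, div_le_div_iff₀ (by positivity) (by positivity), mul_div_assoc',
      div_mul_eq_mul_div, le_div_iff₀ (by positivity)]
    have : (n : ℝ) + 1 - i ≤ 2 * (n - i) := by linarith
    have h3 : (0 : ℝ) ≤ (n + 1) ^ 2 * ((n : ℝ) + 1 - i) := by positivity
    nlinarith [mul_le_mul_of_nonneg_left this h3]

theorem node_gap_ge {n k : ℕ} (hk : k < 2 * n) :
    ((n : ℝ) + 1)⁻¹ ≤ node n (k + 1) - node n k := by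
  rcases Nat.lt_or_ge k n with h | h
  · have := (node_add_gap_bounds (n := n) (i := n - 1 - k) (by omega)).1
    rw [show n + (n - 1 - k) + 1 = 2 * n - k by omega,
      show n + (n - 1 - k) = 2 * n - (k + 1) by omega, node_symm (by omega),
      node_symm (by omega)] at this
    linarith
  · obtain ⟨i, rfl⟩ := Nat.exists_eq_add_of_le h
    exact (node_add_gap_bounds (by omega)).1

theorem node_strictMono {n k : ℕ} (hk : k < 2 * n) : node n k < node n (k + 1) := by
  have h1 := node_gap_ge hk
  have h2 : (0 : ℝ) < ((n : ℝ) + 1)⁻¹ := by positivity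
  linarith

theorem abs_node_le {n k : ℕ} (hk : k ≤ 2 * n) : |node n k| ≤ n := by
  have hk' : (k : ℝ) ≤ 2 * n := by exact_mod_cast hk
  have h : |(k : ℝ) - n| ≤ n :=
    abs_le.2 ⟨by linarith [(Nat.cast_nonneg k : (0 : ℝ) ≤ k)], by linarith⟩
  rw [node, abs_div, abs_of_pos (by linarith : (0 : ℝ) < n + 1 - |(k : ℝ) - n|),
    div_le_iff₀ (by linarith)]
  nlinarith [abs_nonneg ((k : ℝ) - n), (Nat.cast_nonneg n : (0 : ℝ) ≤ n)]

theorem sub_node_le {n k : ℕ} (hn : 1 ≤ n) (hk : k ≤ 2 * n) {s : ℝ} (hs : node n k ≤ s)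
    (hs' : k < 2 * n → s - node n k < node n (k + 1) - node n k) :
    s - node n k ≤ 4 * (1 + s ^ 2) / n := by
  have hn' : (1 : ℝ) ≤ n := by exact_mod_cast hn
  have aux : ∀ v : ℝ, 0 ≤ v → v ≤ |s| → 2 * (1 + v) ^ 2 / ((n : ℝ) + 1) ≤ 4 * (1 + s ^ 2) / n := by
    intro v hv hvs
    have : v ^ 2 ≤ s ^ 2 := by rw [← sq_abs s]; gcongr
    exact div_le_div₀ (by positivity) (by nlinarith [sq_nonneg (1 - v)]) (by linarith)
      (by linarith)
  rcases Nat.lt_or_ge k n with h | h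
  · have h1 := (node_add_gap_bounds (n := n) (i := n - 1 - k) (by omega)).2
    have h2 := hs' (by omega)
    have h0 : 0 ≤ node n (n + (n - 1 - k)) := by
      rw [node_add, Nat.cast_sub (by omega), Nat.cast_sub hn]
      have : (k : ℝ) + 1 ≤ n := by exact_mod_cast h
      push_cast
      exact div_nonneg (by linarith) (by linarith [(Nat.cast_nonneg k : (0 : ℝ) ≤ k)])
    have h3 := aux _ h0
    rw [show n + (n - 1 - k) + 1 = 2 * n - k by omega] at h1
    rw [show n + (n - 1 - k) = 2 * n - (k + 1) by omega, node_symm (by omega)] at h0 h1 h3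
    rw [node_symm (by omega)] at h1
    have := h3 (by rw [le_abs]; right; linarith)
    linarith
  · obtain ⟨i, rfl⟩ := Nat.exists_eq_add_of_le h
    have h0 : 0 ≤ node n (n + i) := by
      rw [node_add]
      have : (i : ℝ) ≤ n := by exact_mod_cast (by omega : i ≤ n)
      exact div_nonneg (Nat.cast_nonneg i) (by linarith)
    rcases Nat.lt_or_ge i n with hi | hi
    · have h1 := (node_add_gap_bounds hi).2
      have h2 := hs' (by omega)
      have := aux _ h0 (hs.trans (le_abs_self s))
      linarith
    · obtain rfl : i = n := by omega
      have e : node i (i + i) = i := by rw [node_add]; simp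
      rw [e] at hs ⊢
      rw [le_div_iff₀ (by linarith)]
      nlinarith

theorem abs_sub_node_le {n k : ℕ} (hn : 1 ≤ n) (hk : k ≤ 2 * n) {s : ℝ}
    (h1 : k < 2 * n → s - node n k < node n (k + 1) - node n k)
    (h2 : 0 < k → node n k - s < node n k - node n (k - 1)) :
    |s - node n k| ≤ 4 * (1 + s ^ 2) / n := by
  rcases le_total (node n k) s with h | h
  · rw [abs_of_nonneg (sub_nonneg.2 h)]
    exact sub_node_le hn hk h h1
  · rw [abs_of_nonpos (sub_nonpos.2 h)]
    have := sub_node_le (k := 2 * n - k) (s := -s) hn (by omega)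
      (by rw [node_symm hk]; linarith) (fun hk' => by
        rw [show 2 * n - k + 1 = 2 * n - (k - 1) by omega, node_symm hk, node_symm (by omega)]
        have := h2 (by omega)
        linarith)
    rw [node_symm hk, neg_sq] at this
    linarith

end Nodes

/-! ### The Kuhn partition of unity and the trunk networks. -/

section Trunk

theorem norm_le_mul_of_abs_le {d : ℕ} {z : EuclideanSpace ℝ (Fin d)} {c : ℝ} (hc : 0 ≤ c)
    (hz : ∀ i, |z i| ≤ c) : ‖z‖ ≤ d * c := by
  rw [EuclideanSpace.norm_eq]
  refine Real.sqrt_le_iff.2 ⟨by positivity, ?_⟩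
  calc ∑ i, ‖z i‖ ^ 2 ≤ ∑ _i : Fin d, c ^ 2 :=
        Finset.sum_le_sum fun i _ => pow_le_pow_left₀ (norm_nonneg _) (hz i) 2
    _ = d * c ^ 2 := by simp
    _ ≤ d ^ 2 * c ^ 2 := by
      gcongr
      exact_mod_cast Nat.le_self_pow two_ne_zero d
    _ = (d * c) ^ 2 := by ring

/-- The coordinate hat functions `(±, i) ↦ slope · ReLU (±(y_i - t_{k_i}))`. -/
def hatCoord {d m : ℕ} (t : ℕ → ℝ) (k : Fin d → Fin (m + 1)) (y : Fin d → ℝ) :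
    Bool × Fin d → ℝ
  | (true, i) => slopeRight t m (k i) * max (y i - t (k i)) 0
  | (false, i) => slopeLeft t (k i) * max (t (k i) - y i) 0

/-- Moves every index of a block of length `d` one step to the right, except for the last. -/
def shiftIndex {d : ℕ} (p : Bool × Fin d) : Bool × Fin d :=
  (p.1, ⟨min (p.2 + 1) (d - 1), by have := p.2.2; omega⟩)

theorem shiftIndex_iterate {d : ℕ} (hd : 0 < d) (b : Bool) (r : ℕ) :
    shiftIndex^[r] (b, ⟨0, hd⟩) = (b, ⟨min r (d - 1), by omega⟩) := by
  induction r with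
  | zero => simp
  | succ r ih =>
    rw [Function.iterate_succ_apply', ih, shiftIndex]
    simp only [Prod.mk.injEq, true_and, Fin.mk.injEq]
    omega

theorem forall_shiftIndex_iterate {d : ℕ} (hd : 0 < d) (b : Bool) (p : Bool × Fin d → Prop) :
    (∀ r ≤ d - 1, p (shiftIndex^[r] (b, ⟨0, hd⟩))) ↔ ∀ i, p (b, i) := by
  simp only [shiftIndex_iterate]
  constructor
  · intro h i
    have := h i (by omega)
    simpa only [min_eq_left (show (i : ℕ) ≤ d - 1 by omega)] using this
  · exact fun h r _ => h _

/-- The nodal basis functions of the Kuhn triangulation of a tensor grid with nodes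
`t 0 < ⋯ < t m` in each coordinate. -/
def kuhnHat {d m : ℕ} (hd : 0 < d) (t : ℕ → ℝ) (k : Fin d → Fin (m + 1)) (y : Fin d → ℝ) : ℝ :=
  max (1 - (maxShift shiftIndex)^[d - 1] (hatCoord t k y) (true, ⟨0, hd⟩) -
    (maxShift shiftIndex)^[d - 1] (hatCoord t k y) (false, ⟨0, hd⟩)) 0

variable {d m : ℕ} {t : ℕ → ℝ}

theorem hatCoord_nonneg (ht : ∀ k < m, t k < t (k + 1)) (k : Fin d → Fin (m + 1))
    (y : Fin d → ℝ) (p : Bool × Fin d) : 0 ≤ hatCoord t k y p := by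
  obtain ⟨_ | _, i⟩ := p
  · exact mul_nonneg (slopeLeft_nonneg ht (Nat.lt_succ_iff.1 (k i).2)) (le_max_right _ _)
  · exact mul_nonneg (slopeRight_nonneg ht _) (le_max_right _ _)

theorem kuhnHat_nonneg (hd : 0 < d) (k : Fin d → Fin (m + 1)) (y : Fin d → ℝ) :
    0 ≤ kuhnHat hd t k y := le_max_right _ _

theorem kuhnHat_le_one (hd : 0 < d) (ht : ∀ k < m, t k < t (k + 1)) (k : Fin d → Fin (m + 1))
    (y : Fin d → ℝ) : kuhnHat hd t k y ≤ 1 := by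
  have h1 := maxShift_iterate_nonneg (f := shiftIndex) (hatCoord_nonneg ht k y) (d - 1)
    (true, ⟨0, hd⟩)
  have h2 := maxShift_iterate_nonneg (f := shiftIndex) (hatCoord_nonneg ht k y) (d - 1)
    (false, ⟨0, hd⟩)
  exact max_le (by linarith) zero_le_one

/-- The set whose length is `kuhnHat hd t k y`. -/
theorem mem_kuhnHat_Ico_iff (hd : 0 < d) (k : Fin d → Fin (m + 1)) (y : Fin d → ℝ) {θ : ℝ} :
    θ ∈ Ico ((maxShift shiftIndex)^[d - 1] (hatCoord t k y) (false, ⟨0, hd⟩))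
        (1 - (maxShift shiftIndex)^[d - 1] (hatCoord t k y) (true, ⟨0, hd⟩)) ↔
      ∀ i, slopeLeft t (k i) * max (t (k i) - y i) 0 ≤ θ ∧
        slopeRight t m (k i) * max (y i - t (k i)) 0 < 1 - θ := by
  rw [mem_Ico, lt_sub_comm, maxShift_iterate_le_iff, maxShift_iterate_lt_iff,
    forall_shiftIndex_iterate hd false fun p => hatCoord t k y p ≤ θ,
    forall_shiftIndex_iterate hd true fun p => hatCoord t k y p < 1 - θ, ← forall_and]
  rfl

/-- Each hat is the length of the set of thresholds `θ ∈ [0, 1)` that round every coordinate of `y`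
to the node `k`. As rounding is unique in each coordinate, these sets partition `[0, 1)`. -/
theorem sum_kuhnHat (hd : 0 < d) (ht : ∀ k < m, t k < t (k + 1)) (y : Fin d → ℝ) :
    ∑ k : Fin d → Fin (m + 1), kuhnHat hd t k y = 1 := by
  let S : (Fin d → Fin (m + 1)) → Set ℝ := fun k =>
    Ico ((maxShift shiftIndex)^[d - 1] (hatCoord t k y) (false, ⟨0, hd⟩))
        (1 - (maxShift shiftIndex)^[d - 1] (hatCoord t k y) (true, ⟨0, hd⟩))
  have hvol : ∀ k, kuhnHat hd t k y = volume.real (S k) := fun k => by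
    rw [Real.volume_real_Ico, kuhnHat]
  have hsub : ∀ k, S k ⊆ Ico 0 1 := fun k =>
    Ico_subset_Ico (maxShift_iterate_nonneg (hatCoord_nonneg ht k y) _ _)
      (sub_le_self _ (maxShift_iterate_nonneg (hatCoord_nonneg ht k y) _ _))
  have hU : ⋃ k ∈ (Finset.univ : Finset (Fin d → Fin (m + 1))), S k = Ico 0 1 := by
    refine Subset.antisymm (iUnion₂_subset fun k _ => hsub k) fun θ hθ => ?_
    choose k hk _ using fun i => existsUnique_node ht hθ.1 hθ.2 (y i)
    exact mem_iUnion₂.2 ⟨k, Finset.mem_univ _, (mem_kuhnHat_Ico_iff hd k y).2 hk⟩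
  have hdisj : ((Finset.univ : Finset (Fin d → Fin (m + 1))) : Set _).PairwiseDisjoint S := by
    intro k _ k' _ hne
    refine disjoint_left.2 fun θ h1 h2 => hne (funext fun i => ?_)
    have hθ := hsub k h1
    exact (existsUnique_node ht hθ.1 hθ.2 (y i)).unique ((mem_kuhnHat_Ico_iff hd k y).1 h1 i)
      ((mem_kuhnHat_Ico_iff hd k' y).1 h2 i)
  rw [Finset.sum_congr rfl fun k _ => hvol k, ← measureReal_biUnion_finset hdisj
    (fun k _ => measurableSet_Ico) (fun k _ => measure_Ico_lt_top.ne), hU, Real.volume_real_Ico]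
  simp

theorem kuhnHat_node_close (hd : 0 < d) {n : ℕ} (hn : 1 ≤ n) {k : Fin d → Fin (2 * n + 1)}
    {y : Fin d → ℝ} (h : kuhnHat hd (node n) k y ≠ 0) (i : Fin d) :
    |y i - node n (k i)| ≤ 4 * (1 + y i ^ 2) / n := by
  have ht : ∀ k < 2 * n, node n k < node n (k + 1) := fun k hk => node_strictMono hk
  have hA := maxShift_iterate_nonneg (f := shiftIndex) (hatCoord_nonneg ht k y) (d - 1)
    (true, ⟨0, hd⟩)
  have hB := maxShift_iterate_nonneg (f := shiftIndex) (hatCoord_nonneg ht k y) (d - 1)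
    (false, ⟨0, hd⟩)
  have hlt : (maxShift shiftIndex)^[d - 1] (hatCoord (node n) k y) (false, ⟨0, hd⟩) <
      1 - (maxShift shiftIndex)^[d - 1] (hatCoord (node n) k y) (true, ⟨0, hd⟩) := by
    by_contra hle
    exact h (max_eq_right (by linarith))
  -- A nonzero hat has a nonempty threshold interval; its left end witnesses that each `y i` lies
  -- within a gap adjacent to its node.
  obtain ⟨h1, h2⟩ := (mem_kuhnHat_Ico_iff hd k y).1 (left_mem_Ico.2 hlt) i
  have hk : (k i : ℕ) ≤ 2 * n := Nat.lt_succ_iff.1 (k i).2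
  rw [slopeLeft_mul_le_iff ht hk hB] at h1
  rw [slopeRight_mul_lt_iff ht (by linarith)] at h2
  refine abs_sub_node_le hn hk (fun h' => (h2 h').trans_le ?_) (fun h' => (h1 h').trans_lt ?_)
  · exact mul_le_of_le_one_right (sub_pos.2 (ht _ h')).le (by linarith)
  · have := ht (k i - 1) (by omega)
    rw [Nat.sub_add_cancel h'] at this
    exact mul_lt_of_lt_one_right (sub_pos.2 this) (by linarith)

theorem abs_slopeRight_node_le (n k : ℕ) : |slopeRight (node n) (2 * n) k| ≤ n + 1 := by
  unfold slopeRight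
  split_ifs with h
  · have := node_gap_ge h
    rw [abs_inv, inv_le_comm₀ (abs_pos.2 (sub_pos.2 (node_strictMono h)).ne') (by positivity)]
    exact this.trans (le_abs_self _)
  · rw [abs_zero]; positivity

theorem abs_slopeLeft_node_le {n k : ℕ} (hk : k ≤ 2 * n) : |slopeLeft (node n) k| ≤ n + 1 := by
  unfold slopeLeft
  split_ifs with h
  · have := abs_slopeRight_node_le n (k - 1)
    rwa [slopeRight, if_pos (by omega), Nat.sub_add_cancel h] at this
  · rw [abs_zero]; positivity

/-- The Kuhn hat functions are computed by ReLU networks of a size which does not depend on the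
grid. -/
theorem exists_kuhnHat_node_mem_FNN (hd : 0 < d) : ∃ L w s : ℕ, ∀ n : ℕ,
    ∀ k : Fin d → Fin (2 * n + 1), kuhnHat hd (node n) k ∈ FNN d L w s (n + 1) 1 := by
  -- The sizes are left as metavariables created before `n` and `k`, so unification can only fill
  -- them with terms in `d`.
  apply Exists.intro
  apply Exists.intro
  apply Exists.intro
  intro n k
  have ht : ∀ k < 2 * n, node n k < node n (k + 1) := fun k hk => node_strictMono hk
  have hκ : (1 : ℝ) ≤ n + 1 := by linarith [(Nat.cast_nonneg n : (0 : ℝ) ≤ n)]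
  have hκ0 : (0 : ℝ) ≤ n + 1 := zero_le_one.trans hκ
  have hk : ∀ i, ((k i : ℕ)) ≤ 2 * n := fun i => Nat.lt_succ_iff.1 (k i).2
  have h1 := HiddenFeatures.first (n := d) (κ := n + 1) (ι := Bool × Fin d)
    (fun p j => if j = p.2 then (if p.1 then 1 else -1) else 0)
    (fun p => if p.1 then -node n (k p.2) else node n (k p.2))
    (by rintro ⟨_ | _, i⟩ j <;> by_cases e : j = i <;> simp [e, hκ0])
    (by rintro ⟨_ | _, i⟩ <;> simpa using (abs_node_le (hk i)).trans (by linarith))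
  -- Slopes get a layer of their own: merged into the first layer they would give biases slope times
  -- node, of order `n²`, instead of parameters at most `n + 1`.
  have h2 := h1.step (ι' := Bool × Fin d)
    (fun p p' => if p' = p then (if p.1 then slopeRight (node n) (2 * n) (k p.2)
      else slopeLeft (node n) (k p.2)) else 0) (fun _ => 0)
    (by
      rintro ⟨b, i⟩ p'
      by_cases e : p' = (b, i)
      · cases b
        · simpa [e] using abs_slopeLeft_node_le (hk i)
        · simpa [e] using abs_slopeRight_node_le n (k i)
      · simpa [e] using hκ0)
    (fun _ => by simpa using hκ0)
  have h3 : HiddenFeatures (hatCoord (node n) k) _ _ _ ((n : ℝ) + 1) := h2.congr fun y p => by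
    have h0 := hatCoord_nonneg ht k y p
    obtain ⟨_ | _, i⟩ := p
    · simp only [hatCoord] at h0
      simp [hatCoord, max_eq_left h0, ← sub_eq_neg_add]
    · simp only [hatCoord] at h0
      simp [hatCoord, max_eq_left h0, ← sub_eq_add_neg]
  have h4 := (h3.maxShift_iterate hκ (hatCoord_nonneg ht k) shiftIndex (d - 1)).step (ι' := Unit)
    (fun _ p => if p.2 = ⟨0, hd⟩ then -1 else 0) (fun _ => 1)
    (by rintro _ ⟨b, i⟩; by_cases e : i = ⟨0, hd⟩ <;> simp [e, hκ0])
    (fun _ => by simp)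
  refine h4.mem_FNN (fun _ => 1) 0 (fun _ => by simp) (by simpa using hκ0)
    (fun y => ?_) (fun y => ?_)
  · simp only [kuhnHat, Fintype.sum_prod_type, Fintype.sum_bool, ite_mul, zero_mul,
      Finset.sum_ite_eq', Finset.mem_univ, if_true, Finset.univ_unique, Finset.sum_singleton]
    ring_nf
  · rw [abs_of_nonneg (kuhnHat_nonneg hd k y), ← ENNReal.ofReal_one]
    exact ENNReal.ofReal_le_ofReal (kuhnHat_le_one hd ht k y)

/-- Trunk networks: a partition of unity by `(2n+1)^d` networks of bounded size which is subordinate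
to balls whose radius near `y` is of order `(1 + |y|²) / n`. -/
theorem exists_trunk (d : ℕ) (hd : 1 ≤ d) : ∃ L w s : ℕ, ∀ n : ℕ, 1 ≤ n →
    ∃ (q : Fin ((2 * n + 1) ^ d) → (Fin d → ℝ) → ℝ)
      (t : Fin ((2 * n + 1) ^ d) → EuclideanSpace ℝ (Fin d)),
      (∀ k, q k ∈ FNN d L w s (n + 1) 1) ∧ (∀ k y, 0 ≤ q k y) ∧ (∀ y, ∑ k, q k y = 1) ∧
      (∀ k, ‖t k‖ ≤ d * n) ∧
      ∀ k (y : EuclideanSpace ℝ (Fin d)), q k y ≠ 0 → ‖y - t k‖ ≤ 4 * d * (1 + ‖y‖ ^ 2) / n := by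
  obtain ⟨L, w, s, h⟩ := exists_kuhnHat_node_mem_FNN (d := d) hd
  refine ⟨L, w, s, fun n hn => ?_⟩
  have hn' : (0 : ℝ) < n := by exact_mod_cast hn
  obtain ⟨e⟩ : Nonempty ((Fin d → Fin (2 * n + 1)) ≃ Fin ((2 * n + 1) ^ d)) :=
    ⟨finFunctionFinEquiv⟩
  refine ⟨fun k => kuhnHat hd (node n) (e.symm k),
    fun k => WithLp.toLp 2 fun i => node n (e.symm k i), fun k => h n _,
    fun k y => kuhnHat_nonneg hd _ y, fun y => ?_, fun k => norm_le_mul_of_abs_le hn'.le fun i => ?_,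
    fun k y hk => ?_⟩
  · have h1 := sum_kuhnHat hd (t := node n) (m := 2 * n) (fun k hk => node_strictMono hk) y
    rw [← e.symm.sum_comp] at h1
    exact h1
  · have hk : ((e.symm k i : Fin (2 * n + 1)) : ℕ) ≤ 2 * n := Nat.lt_succ_iff.1 (e.symm k i).2
    exact abs_node_le hk
  · refine (norm_le_mul_of_abs_le (c := 4 * (1 + ‖y‖ ^ 2) / n) (by positivity) fun i => ?_).trans (le_of_eq (by ring))
    refine (kuhnHat_node_close hd hn hk i).trans ?_
    have : y i ^ 2 ≤ ‖y‖ ^ 2 := by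
      rw [← sq_abs, ← Real.norm_eq_abs]
      exact pow_le_pow_left₀ (norm_nonneg _) (PiLp.norm_apply_le y i) 2
    gcongr

end Trunk

/-! ### A partition of unity on sample space by shallow networks. -/

section Branch

variable {K M : ℕ}

/-- A bump around the point `s j`, in the `ℓ¹` norm. -/
def bump (n : ℝ) (s : Fin K → Fin M → ℝ) (v : Fin M → ℝ) (j : Fin K) : ℝ :=
  max (2 - n * ∑ m, |v m - s j m|) 0

/-- The part of `1` which is not used up by the first `j` bumps. -/
def bumpRest (n : ℝ) (s : Fin K → Fin M → ℝ) (v : Fin M → ℝ) (j : ℕ) : ℝ :=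
  max (1 - ∑ i : Fin K, if (i : ℕ) < j then bump n s v i else 0) 0

/-- A partition of unity subordinate to the supports of the bumps. -/
def bumpWeight (n : ℝ) (s : Fin K → Fin M → ℝ) (v : Fin M → ℝ) (j : Fin K) : ℝ :=
  bumpRest n s v j - bumpRest n s v (j + 1)

variable {n : ℝ} {s : Fin K → Fin M → ℝ} {v : Fin M → ℝ}

theorem bump_nonneg (j : Fin K) : 0 ≤ bump n s v j := le_max_right _ _

theorem bumpWeight_nonneg (j : Fin K) : 0 ≤ bumpWeight n s v j := by
  refine sub_nonneg.2 (max_le_max (sub_le_sub_left (Finset.sum_le_sum fun i _ => ?_) 1) le_rfl)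
  split_ifs with h1 h2
  · exact le_rfl
  · omega
  · exact bump_nonneg i
  · exact le_rfl

/-- The sum telescopes to the rest before all bumps, which is `1`, minus the rest after them, which
vanishes because the `j`-th bump alone is at least `1`. -/
theorem sum_bumpWeight {j : Fin K} (h : n * ∑ m, |v m - s j m| ≤ 1) :
    ∑ i, bumpWeight n s v i = 1 := by
  have h1 : (1 : ℝ) ≤ bump n s v j := le_max_of_le_left (by linarith)
  have h2 : bump n s v j ≤ ∑ i : Fin K, bump n s v i :=
    Finset.single_le_sum (fun i _ => bump_nonneg i) (Finset.mem_univ j)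
  calc ∑ i, bumpWeight n s v i
      = ∑ i ∈ Finset.range K, (bumpRest n s v i - bumpRest n s v (i + 1)) :=
        Fin.sum_univ_eq_sum_range (fun i => bumpRest n s v i - bumpRest n s v (i + 1)) K
    _ = bumpRest n s v 0 - bumpRest n s v K := Finset.sum_range_sub' _ _
    _ = 1 := by
      simp only [bumpRest, Nat.not_lt_zero, if_false, Finset.sum_const_zero, Fin.is_lt, if_true]
      rw [max_eq_right (by linarith : 1 - ∑ i : Fin K, bump n s v i ≤ 0)]
      norm_num

theorem mul_abs_sub_le_of_bumpWeight_ne_zero (hn : 0 ≤ n) {j : Fin K}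
    (h : bumpWeight n s v j ≠ 0) (m : Fin M) : n * |v m - s j m| ≤ 2 := by
  by_contra! hlt
  have h1 : |v m - s j m| ≤ ∑ m, |v m - s j m| :=
    Finset.single_le_sum (f := fun m => |v m - s j m|) (fun _ _ => abs_nonneg _)
      (Finset.mem_univ m)
  have h2 : bump n s v j = 0 := max_eq_right (by nlinarith)
  refine h (sub_eq_zero.2 ?_)
  unfold bumpRest
  congr 2
  refine Finset.sum_congr rfl fun i _ => ?_
  rcases eq_or_ne i j with rfl | hij
  · simp [h2]
  · have : (i : ℕ) ≠ j := fun e => hij (Fin.ext e)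
    congr 1
    exact propext (by omega)

/-- The hidden layers compute the two halves of `|v m - s j m|`, the bumps, and the rests before and
after each bump. Differences of rests are linear, so subtracting bumps successively replaces a
normalisation by division. -/
theorem sum_mul_bumpWeight_mem_FNN {N : ℕ} (pos : Fin M → Fin N) (hM : 1 ≤ M) {κ : ℝ}
    (h2 : 2 ≤ κ) (hn : |n| ≤ κ) (hs : ∀ j m, |s j m| ≤ κ) (a : Fin K → ℝ) (ha : ∀ j, |a j| ≤ κ) :
    (fun v : Fin N → ℝ => ∑ j, a j * bumpWeight n s (fun m => v (pos m)) j) ∈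
      FNN N 4 (2 * K * M) (2 * K * M * (N + 1) + K * (2 * K * M + 1) + 2 * K * (K + 1) +
        (2 * K + 1)) κ ⊤ := by
  have hκ0 : 0 ≤ κ := by linarith
  have hκ1 : 1 ≤ κ := by linarith
  have f1 := HiddenFeatures.first (n := N) (κ := κ) (ι := (Fin K × Fin M) × Bool)
    (fun p i => if i = pos p.1.2 then (if p.2 then 1 else -1) else 0)
    (fun p => if p.2 then -s p.1.1 p.1.2 else s p.1.1 p.1.2)
    (by rintro ⟨⟨j, m⟩, _ | _⟩ i <;> by_cases e : i = pos m <;> simp [e, hκ0, hκ1])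
    (by rintro ⟨⟨j, m⟩, _ | _⟩ <;> simpa using hs j m)
  have f2 := (f1.step (ι' := Fin K) (fun j p => if p.1.1 = j then -n else 0) (fun _ => 2)
    (fun j p => by by_cases e : p.1.1 = j <;> simp [e, hκ0, hn])
    (fun _ => by simpa using h2)).congr (h' := fun v j => bump n s (fun m => v (pos m)) j)
    fun v j => by
      have habs : ∀ u : ℝ, max u 0 + max (-u) 0 = |u| := fun u => by
        rcases le_total 0 u with h | h
        · rw [max_eq_left h, max_eq_right (by linarith), abs_of_nonneg h, add_zero]
        · rw [max_eq_right h, max_eq_left (by linarith), abs_of_nonpos h, zero_add]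
      have h : ∀ m, |v (pos m) - s j m| = max (v (pos m) + -s j m) 0 +
          max (-v (pos m) + s j m) 0 := fun m => by
        rw [← habs, neg_sub, ← sub_eq_add_neg, neg_add_eq_sub]
      simp only [bump, h]
      congr 1
      simp [Fintype.sum_prod_type, Finset.mul_sum, mul_add, ite_mul, Finset.sum_add_distrib]
      ring
  have f3 := (f2.step (ι' := Fin K × Bool)
    (fun p i => if (i : ℕ) < p.1 + (if p.2 then 1 else 0) then -1 else 0) (fun _ => 1)
    (fun p i => by
      generalize (p.1 : ℕ) + (if p.2 then 1 else 0) = r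
      by_cases e : (i : ℕ) < r <;> simp [e, hκ0, hκ1])
    (fun _ => by simpa using hκ1)).congr
    (h' := fun v p => bumpRest n s (fun m => v (pos m)) (p.1 + (if p.2 then 1 else 0)))
    fun v p => by
      simp only [bumpRest, ite_mul, zero_mul, neg_one_mul]
      rw [sub_eq_add_neg, add_comm, ← Finset.sum_neg_distrib]
      congr 3
      funext i
      split_ifs <;> simp
  have f4 : HiddenFeatures _ _ (2 * K * M) _ κ := f3.mono (w' := 2 * K * M) (by
    have e1 : K * 1 ≤ K * M := Nat.mul_le_mul_left K hM
    have e2 : K * M * 2 = 2 * K * M := by ring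
    simp only [Fintype.card_prod, Fintype.card_fin, Fintype.card_bool, max_le_iff, e2]
    rw [mul_assoc]
    omega) le_rfl
  have f5 := f4.mem_FNN (fun p => a p.1 * (if p.2 then -1 else 1)) 0
    (by rintro ⟨j, _ | _⟩ <;> simpa using ha j) (by simpa using hκ0)
    (q := fun v : Fin N → ℝ => ∑ j, a j * bumpWeight n s (fun m => v (pos m)) j) (R := ⊤)
    (fun v => by
      simp only [Fintype.sum_prod_type, Fintype.sum_bool, add_zero, bumpWeight]
      refine Finset.sum_congr rfl fun j _ => ?_
      simp
      ring)
    (fun _ => le_top)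
  simp only [Fintype.card_prod, Fintype.card_fin, Fintype.card_bool] at f5
  convert f5 using 1
  ring_nf

end Branch

/-! ### Finite nets: representatives in `G`, and a grid of sampling points. -/

section Covering

theorem exists_cover {G : Type*} [Nonempty G] {M J : ℕ} (v : G → Fin M → ℝ) {b δ : ℝ}
    (hδ : 0 < δ) (hb : ∀ g m, |v g m| ≤ b) (hJ : 2 * b / δ < J) :
    ∃ r : Fin (J ^ M) → G, ∀ g, ∃ j, ∀ m, |v g m - v (r j) m| ≤ δ := by
  obtain ⟨e⟩ : Nonempty ((Fin M → Fin J) ≃ Fin (J ^ M)) := ⟨finFunctionFinEquiv⟩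
  have h0 : ∀ g m, 0 ≤ (v g m + b) / δ := fun g m =>
    div_nonneg (by linarith [(abs_le.1 (hb g m)).1]) hδ.le
  have hJ' : ∀ g m, ⌊(v g m + b) / δ⌋₊ < J := fun g m => by
    rw [Nat.floor_lt (h0 g m)]
    refine lt_of_le_of_lt ?_ hJ
    gcongr
    linarith [(abs_le.1 (hb g m)).2]
  let cell : G → Fin (J ^ M) := fun g => e fun m => ⟨⌊(v g m + b) / δ⌋₊, hJ' g m⟩
  -- One member of `G` per occupied cell; the values at empty cells are arbitrary and harmless.
  refine ⟨Function.invFun cell, fun g => ⟨cell g, fun m => ?_⟩⟩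
  have h1 : cell (Function.invFun cell (cell g)) = cell g :=
    Function.invFun_eq ⟨g, rfl⟩
  have h2 := congrArg Fin.val (congrFun (e.injective h1) m)
  simp only at h2
  have a1 := Nat.floor_le (h0 g m)
  have a2 := Nat.lt_floor_add_one ((v g m + b) / δ)
  have b1 := Nat.floor_le (h0 (Function.invFun cell (cell g)) m)
  have b2 := Nat.lt_floor_add_one ((v (Function.invFun cell (cell g)) m + b) / δ)
  rw [h2] at b1 b2
  have h3 : |(v g m + b) / δ - (v (Function.invFun cell (cell g)) m + b) / δ| ≤ 1 :=
    abs_le.2 ⟨by linarith, by linarith⟩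
  rwa [← sub_div, add_sub_add_right_eq_sub, abs_div, abs_of_pos hδ, div_le_one hδ] at h3

theorem exists_grid (d : ℕ) {n : ℕ} (hn : 1 ≤ n) :
    ∃ c : Fin ((2 * n ^ 2 + 1) ^ d) → EuclideanSpace ℝ (Fin d), (∀ i, ‖c i‖ ≤ d * n) ∧
      ∀ z : EuclideanSpace ℝ (Fin d), ‖z‖ ≤ n → ∃ i, ‖z - c i‖ ≤ d / n := by
  have hn' : (0 : ℝ) < n := by exact_mod_cast hn
  obtain ⟨e⟩ : Nonempty ((Fin d → Fin (2 * n ^ 2 + 1)) ≃ Fin ((2 * n ^ 2 + 1) ^ d)) :=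
    ⟨finFunctionFinEquiv⟩
  refine ⟨fun i => WithLp.toLp 2 fun l => (((e.symm i l : ℕ) : ℝ) - n ^ 2) / n,
    fun i => norm_le_mul_of_abs_le hn'.le fun l => ?_, fun z hz => ?_⟩
  · have h1 : ((e.symm i l : ℕ) : ℝ) ≤ 2 * n ^ 2 := by
      exact_mod_cast Nat.lt_succ_iff.1 (e.symm i l).2
    have h2 : (0 : ℝ) ≤ ((e.symm i l : ℕ) : ℝ) := Nat.cast_nonneg _
    simp only
    rw [abs_div, abs_of_pos hn', div_le_iff₀ hn', abs_le]
    constructor <;> nlinarith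
  · have hz' : ∀ l, |z l| ≤ n := fun l => (PiLp.norm_apply_le z l).trans hz
    have h0 : ∀ l, 0 ≤ z l * n + n ^ 2 := fun l => by nlinarith [(abs_le.1 (hz' l)).1]
    have hlt : ∀ l, ⌊z l * n + n ^ 2⌋₊ < 2 * n ^ 2 + 1 := fun l => by
      rw [Nat.floor_lt (h0 l)]
      push_cast
      nlinarith [(abs_le.1 (hz' l)).2]
    refine ⟨e fun l => ⟨⌊z l * n + n ^ 2⌋₊, hlt l⟩, ?_⟩
    rw [div_eq_mul_inv]
    refine norm_le_mul_of_abs_le (by positivity) fun l => ?_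
    have h1 := Nat.floor_le (h0 l)
    have h2 := Nat.lt_floor_add_one (z l * n + n ^ 2)
    simp only [PiLp.sub_apply, Equiv.symm_apply_apply]
    rw [← one_div, le_div_iff₀ hn', ← abs_of_pos hn', ← abs_mul, abs_of_pos hn', sub_mul,
      div_mul_cancel₀ _ hn'.ne', abs_le]
    constructor <;> linarith

end Covering

/-! ### Deterministic error bounds and their expectations. -/

section Approximation

theorem abs_le_of_lipschitz {E : Type*} [SeminormedAddCommGroup E] {f : E → ℝ} {L : ℝ≥0}
    (hf : LipschitzWith L f) (z w : E) : |f z - f w| ≤ L * ‖z - w‖ := by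
  simpa [Real.dist_eq, dist_eq_norm] using hf.dist_le_mul z w

theorem abs_sub_le_growth {E : Type*} [SeminormedAddCommGroup E] {g g' : E → ℝ} {L : ℝ≥0} {c : ℝ}
    (hg : LipschitzWith L g) (hg' : LipschitzWith L g') (h0 : |g 0| ≤ c) (h0' : |g' 0| ≤ c) (z : E) :
    |g z - g' z| ≤ 2 * c + 2 * L * ‖z‖ := by
  have h1 := abs_le_of_lipschitz hg z 0
  have h2 := abs_le_of_lipschitz hg' z 0
  rw [sub_zero] at h1 h2
  rw [abs_le] at *
  constructor <;> linarith

/-- Lipschitz functions which are close on a grid of mesh `1 / n` in `[-n, n]^d` are close in a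
quadratically weighted norm. -/
theorem abs_sub_le_of_close_on_grid {d : ℕ} {n : ℕ} (hn : 1 ≤ n) {ι : Type*}
    {p : ι → EuclideanSpace ℝ (Fin d)} (hp : ∀ z, ‖z‖ ≤ n → ∃ i, ‖z - p i‖ ≤ d / n)
    {g g' : EuclideanSpace ℝ (Fin d) → ℝ} {L : ℝ≥0} {c : ℝ} (hc : 0 ≤ c)
    (hg : LipschitzWith L g) (hg' : LipschitzWith L g') (h0 : |g 0| ≤ c) (h0' : |g' 0| ≤ c)
    (hclose : ∀ i, n * |g (p i) - g' (p i)| ≤ 2) (z : EuclideanSpace ℝ (Fin d)) :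
    |g z - g' z| ≤ (2 * c + 2 * L + 2 * L * d + 2) / n * (1 + ‖z‖ ^ 2) := by
  have hn' : (1 : ℝ) ≤ n := by exact_mod_cast hn
  have hL : (0 : ℝ) ≤ L := L.2
  rw [div_mul_eq_mul_div, le_div_iff₀ (by linarith)]
  rcases le_total ‖z‖ n with hz | hz
  · obtain ⟨i, hi⟩ := hp z hz
    have h1 := abs_le_of_lipschitz hg z (p i)
    have h2 := abs_le_of_lipschitz hg' z (p i)
    have h3 : |g z - g' z| ≤ 2 * (L * (d / n)) + |g (p i) - g' (p i)| := by
      have h4 := mul_le_mul_of_nonneg_left hi hL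
      calc |g z - g' z| = |(g z - g (p i)) + (g (p i) - g' (p i)) - (g' z - g' (p i))| := by ring_nf
        _ ≤ |g z - g (p i)| + |g (p i) - g' (p i)| + |g' z - g' (p i)| :=
          (abs_sub _ _).trans (add_le_add_left (abs_add_le _ _) _)
        _ ≤ _ := by linarith
    calc |g z - g' z| * n ≤ (2 * (L * (d / n)) + |g (p i) - g' (p i)|) * n := by gcongr
      _ = 2 * L * d + n * |g (p i) - g' (p i)| := by field_simp
      _ ≤ 2 * L * d + 2 := by linarith [hclose i]
      _ ≤ (2 * c + 2 * L + 2 * L * d + 2) * 1 := by linarith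
      _ ≤ (2 * c + 2 * L + 2 * L * d + 2) * (1 + ‖z‖ ^ 2) := by
        gcongr
        linarith [sq_nonneg ‖z‖]
  -- Outside the ball the grid gives nothing, but linear growth suffices: `n ≤ ‖z‖` turns it into
  -- quadratic growth with a factor `1 / n`.
  · have h1 := abs_sub_le_growth hg hg' h0 h0' z
    have hz1 : 1 ≤ ‖z‖ := hn'.trans hz
    calc |g z - g' z| * n ≤ (2 * c * ‖z‖ + 2 * L * ‖z‖) * ‖z‖ := by
          gcongr
          exact h1.trans (add_le_add_left (le_mul_of_one_le_right (by positivity) hz1) _)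
      _ = (2 * c + 2 * L) * ‖z‖ ^ 2 := by ring
      _ ≤ (2 * c + 2 * L + 2 * L * d + 2) * (1 + ‖z‖ ^ 2) := by
        have := mul_nonneg hL (Nat.cast_nonneg d : (0 : ℝ) ≤ d)
        exact mul_le_mul (by linarith) (by linarith) (by positivity) (by linarith)

/-- Quasi-interpolation of a Lipschitz function by a partition of unity. -/
theorem abs_sub_sum_mul_le {d N : ℕ} {ρ : ℝ} {q : Fin N → ℝ} {t : Fin N → EuclideanSpace ℝ (Fin d)}
    {y : EuclideanSpace ℝ (Fin d)} (hq : ∀ k, 0 ≤ q k) (hsum : ∑ k, q k = 1)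
    (hloc : ∀ k, q k ≠ 0 → ‖y - t k‖ ≤ ρ) {u : EuclideanSpace ℝ (Fin d) → ℝ} {L : ℝ≥0}
    (hu : LipschitzWith L u) : |u y - ∑ k, u (t k) * q k| ≤ L * ρ := by
  calc |u y - ∑ k, u (t k) * q k| = |∑ k, (u y - u (t k)) * q k| := by
        simp only [sub_mul, Finset.sum_sub_distrib, ← Finset.mul_sum, hsum, mul_one]
    _ ≤ ∑ k, |(u y - u (t k)) * q k| := Finset.abs_sum_le_sum_abs _ _
    _ ≤ ∑ k, L * ρ * q k := by
        refine Finset.sum_le_sum fun k _ => ?_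
        rw [abs_mul, abs_of_nonneg (hq k)]
        by_cases h : q k = 0
        · simp [h]
        · exact mul_le_mul_of_nonneg_right ((abs_le_of_lipschitz hu _ _).trans
            (mul_le_mul_of_nonneg_left (hloc k h) L.2)) (hq k)
    _ = L * ρ := by rw [← Finset.mul_sum, hsum, mul_one]

variable {T : ℝ} {Ω : Type*} {m : MeasurableSpace Ω} {P : Measure Ω} [IsProbabilityMeasure P]
  {d : ℕ} {Y : Icc (0 : ℝ) T → Ω → EuclideanSpace ℝ (Fin d)}

/-- The constant `|u 0|` is its own expectation, and at time `0` it is at most `|u (Y 0)| + L * ‖Y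
0‖`. This turns `S²` bounds on outputs into the pointwise bounds needed for network weights. -/
theorem abs_apply_zero_le (hT : 0 ≤ T) {M s : ℝ} (hs : 0 ≤ s)
    (hM : expect P (fun ω => ⨆ t, ENNReal.ofReal (‖Y t ω‖ ^ (1 : ℝ))) ≤ ENNReal.ofReal M)
    {u : EuclideanSpace ℝ (Fin d) → ℝ} {L : ℝ≥0} (hu : LipschitzWith L u)
    (hus : expect P (fun ω => ⨆ t, ENNReal.ofReal |u (Y t ω)|) ≤ ENNReal.ofReal s) :
    |u 0| ≤ s + L * (1 + |M|) := by
  rw [← ENNReal.ofReal_le_ofReal_iff (by positivity)]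
  have hg : expect P (fun ω => ⨆ t, ENNReal.ofReal ((fun z => L * ‖z‖) (Y t ω)))
      ≤ ENNReal.ofReal (L * (1 + |M|)) :=
    expect_iSup_le_of_growth (F := fun z => L * ‖z‖) L.2 1 (by exact_mod_cast hM) fun z => by
      rw [pow_one]
      exact mul_le_mul_of_nonneg_left (by linarith) L.2
  calc ENNReal.ofReal |u 0| = expect P (fun _ => ENNReal.ofReal |u 0|) := (expect_const _).symm
    _ ≤ expect P (fun ω => (⨆ t, ENNReal.ofReal |u (Y t ω)|) +
          ⨆ t, ENNReal.ofReal ((fun z => L * ‖z‖) (Y t ω))) := by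
        refine expect_mono fun ω => ?_
        let t₀ : Icc (0 : ℝ) T := ⟨0, left_mem_Icc.2 hT⟩
        refine le_trans ?_ (add_le_add (le_iSup _ t₀) (le_iSup _ t₀))
        rw [← ENNReal.ofReal_add (abs_nonneg _) (by positivity)]
        refine ENNReal.ofReal_le_ofReal ?_
        have h1 := abs_le_of_lipschitz hu (Y t₀ ω) 0
        rw [sub_zero] at h1
        have h2 := abs_sub_abs_le_abs_sub (u 0) (u (Y t₀ ω))
        rw [abs_sub_comm] at h2
        linarith
    _ ≤ ENNReal.ofReal s + ENNReal.ofReal (L * (1 + |M|)) :=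
        (expect_add_le _ _).trans (add_le_add hus hg)
    _ = _ := (ENNReal.ofReal_add hs (by positivity)).symm

/-- The error of a convex combination of interpolated approximations. -/
theorem expect_convex_combination_le {K : ℕ} {δ c M : ℝ} (hδ : 0 ≤ δ) (hc : 0 ≤ c)
    (hM : expect P (fun ω => ⨆ t, ENNReal.ofReal (‖Y t ω‖ ^ (2 : ℝ))) ≤ ENNReal.ofReal M)
    {ψ : Fin K → ℝ} (hψ : ∀ j, 0 ≤ ψ j) (hsum : ∑ j, ψ j = 1)
    {u : EuclideanSpace ℝ (Fin d) → ℝ} {v w : Fin K → EuclideanSpace ℝ (Fin d) → ℝ}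
    (huv : ∀ j, ψ j ≠ 0 →
      expect P (fun ω => ⨆ t, ENNReal.ofReal |u (Y t ω) - v j (Y t ω)|) ≤ ENNReal.ofReal δ)
    (hvw : ∀ j z, |v j z - w j z| ≤ c * (1 + ‖z‖ ^ 2)) :
    expect P (fun ω => ⨆ t, ENNReal.ofReal |u (Y t ω) - ∑ j, ψ j * w j (Y t ω)|)
      ≤ ENNReal.ofReal (δ + c * (1 + |M|)) := by
  have hpt : ∀ z, |u z - ∑ j, ψ j * w j z| ≤ ∑ j, ψ j * |u z - v j z| + c * (1 + ‖z‖ ^ 2) := by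
    intro z
    calc |u z - ∑ j, ψ j * w j z| = |∑ j, ψ j * (u z - w j z)| := by
          simp only [mul_sub, Finset.sum_sub_distrib, ← Finset.sum_mul, hsum, one_mul]
      _ ≤ ∑ j, |ψ j * (u z - w j z)| := Finset.abs_sum_le_sum_abs _ _
      _ ≤ ∑ j, (ψ j * |u z - v j z| + ψ j * (c * (1 + ‖z‖ ^ 2))) := by
          refine Finset.sum_le_sum fun j _ => ?_
          rw [abs_mul, abs_of_nonneg (hψ j), ← mul_add]
          refine mul_le_mul_of_nonneg_left ?_ (hψ j)
          exact (abs_sub_le _ (v j z) _).trans (add_le_add_right (hvw j z) _)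
      _ = _ := by rw [Finset.sum_add_distrib, ← Finset.sum_mul, hsum, one_mul]
  calc expect P (fun ω => ⨆ t, ENNReal.ofReal |u (Y t ω) - ∑ j, ψ j * w j (Y t ω)|)
      ≤ expect P (fun ω => (∑ j, ENNReal.ofReal (ψ j) *
          ⨆ t, ENNReal.ofReal |u (Y t ω) - v j (Y t ω)|) +
          ⨆ t, ENNReal.ofReal ((fun z => c * (1 + ‖z‖ ^ 2)) (Y t ω))) := by
        refine expect_mono fun ω => iSup_le fun t => ?_
        refine (ENNReal.ofReal_le_ofReal (hpt _)).trans ?_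
        rw [ENNReal.ofReal_add (Finset.sum_nonneg fun j _ => mul_nonneg (hψ j) (abs_nonneg _))
          (by positivity), ENNReal.ofReal_sum_of_nonneg fun j _ =>
            mul_nonneg (hψ j) (abs_nonneg _)]
        refine add_le_add (Finset.sum_le_sum fun j _ => ?_)
          (le_iSup (fun t => ENNReal.ofReal ((fun z => c * (1 + ‖z‖ ^ 2)) (Y t ω))) t)
        rw [ENNReal.ofReal_mul (hψ j)]
        exact mul_le_mul_right
          (le_iSup (fun t => ENNReal.ofReal |u (Y t ω) - v j (Y t ω)|) t) _
    _ ≤ ∑ j, ENNReal.ofReal (ψ j) * ENNReal.ofReal δ + ENNReal.ofReal (c * (1 + |M|)) := by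
        refine (expect_add_le _ _).trans (add_le_add ?_
          (expect_iSup_le_of_growth (F := fun z => c * (1 + ‖z‖ ^ 2)) hc 2 (by exact_mod_cast hM)
            fun z => le_rfl))
        refine (expect_finset_sum_le _ _).trans (Finset.sum_le_sum fun j _ => ?_)
        refine (expect_const_mul_le ENNReal.ofReal_ne_top _).trans ?_
        by_cases h : ψ j = 0
        · simp [h]
        · exact mul_le_mul_right (huv j h) _
    _ = ENNReal.ofReal (δ + c * (1 + |M|)) := by
        rw [← Finset.sum_mul, ← ENNReal.ofReal_sum_of_nonneg fun j _ => hψ j, hsum,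
          ENNReal.ofReal_one, one_mul, ENNReal.ofReal_add hδ (by positivity)]

end Approximation

/-! ### Approximation of a Lipschitz operator at a fixed scale. -/

section Operator

/-- Given trunk networks that form a partition of unity at scale `1 / n`, branch networks which
sample on a grid of mesh `1 / n` approximate every Lipschitz operator to order `1 / n`. -/
theorem exists_branch {T : ℝ} (hT : 0 ≤ T) {Ω : Type*} {m : MeasurableSpace Ω} {P : Measure Ω}
    [IsProbabilityMeasure P] {ℱ : Filtration (Icc (0 : ℝ) T) m} {d₁ d₂ : ℕ}
    {X : Icc (0 : ℝ) T → Ω → EuclideanSpace ℝ (Fin d₁)} {x : EuclideanSpace ℝ (Fin d₁)}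
    {Y : Icc (0 : ℝ) T → Ω → EuclideanSpace ℝ (Fin d₂)} {y : EuclideanSpace ℝ (Fin d₂)}
    {MX MY : ℝ → ℝ} {cX CX αX cY CY αY : ℝ}
    (hX : IsModelProcess hT P ℱ X x MX cX CX αX) (hY : IsModelProcess hT P ℱ Y y MY cY CY αY)
    {G : Set (EuclideanSpace ℝ (Fin d₁) → ℝ)} {c₀ : ℝ} {Lg Lu LΓ B : ℝ≥0}
    (hG₀ : ∀ g ∈ G, |g 0| ≤ c₀) (hG : ∀ g ∈ G, LipschitzWith Lg g)
    {U : Set (EuclideanSpace ℝ (Fin d₂) → ℝ)} (hU : ∀ u ∈ U, LipschitzWith Lu u)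
    {n A b : ℕ} (hn : 1 ≤ n) (hA : 1 ≤ A) (hb : c₀ + Lg * d₁ ≤ b) (hc₀ : 0 ≤ c₀)
    {N₁ M J : ℕ} {q : Fin N₁ → (Fin d₂ → ℝ) → ℝ} {t : Fin N₁ → EuclideanSpace ℝ (Fin d₂)}
    (hq0 : ∀ k y, 0 ≤ q k y) (hq1 : ∀ y, ∑ k, q k y = 1) (ht : ∀ k, ‖t k‖ ≤ d₂ * n)
    (hqt : ∀ k (y : EuclideanSpace ℝ (Fin d₂)), q k y ≠ 0 →
      ‖y - t k‖ ≤ 4 * d₂ * (1 + ‖y‖ ^ 2) / n)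
    (hM : M = (2 * n ^ 2 + 1) ^ d₁) (hJ : J = 2 * b * n ^ 2 * M + 1) {κ : ℝ}
    (hκ : (b + 2 + (B + LΓ * ((2 * c₀ + 2 * Lg) * (2 * (1 + |MX 4|))) + Lu * (1 + |MY 1|)) +
      Lu * d₂) * n ≤ κ) :
    ∃ c : Fin (A * M) → EuclideanSpace ℝ (Fin d₁), ∀ Γ : G → U,
      (∀ g₁ g₂ : G, s2Norm P Y ((Γ g₁).1 - (Γ g₂).1) ≤ LΓ * s2Norm P X (g₁.1 - g₂.1)) →
      (∃ g₀ : G, s2Norm P Y (Γ g₀).1 ≤ B) →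
      ∃ a : Fin N₁ → (Fin (A * M) → ℝ) → ℝ,
        (∀ k, a k ∈ FNN (A * M) 4 (2 * J ^ M * M) (2 * J ^ M * M * (A * M + 1) +
          J ^ M * (2 * J ^ M * M + 1) + 2 * J ^ M * (J ^ M + 1) + (2 * J ^ M + 1)) κ ⊤) ∧
        ⨆ g : G, expect P (fun ω => ⨆ t, ENNReal.ofReal
          |(Γ g).1 (Y t ω) - ∑ k, a k (fun i => g.1 (c i)) * q k (Y t ω)|)
          ≤ ENNReal.ofReal ((LΓ * ((2 * c₀ + 2 * Lg + 2 * Lg * d₁ + 2) * (2 * (1 + |MX 4|))) +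
            4 * d₂ * Lu * (1 + |MY 2|)) / n) := by
  have hn' : (1 : ℝ) ≤ n := by exact_mod_cast hn
  have hn0 : (0 : ℝ) < n := by linarith
  have hM1 : 1 ≤ M := by rw [hM]; exact Nat.one_le_pow _ _ (by omega)
  have hM' : (0 : ℝ) < M := by exact_mod_cast hM1
  have hgrid := exists_grid d₁ hn
  rw [← hM] at hgrid
  obtain ⟨p, hpn, hp⟩ := hgrid
  -- Every grid point is sampled `A` times; the networks read only the first copy.
  let pos : Fin M → Fin (A * M) := fun i => finProdFinEquiv (⟨0, hA⟩, i)
  refine ⟨fun i => p (finProdFinEquiv.symm i).2, fun Γ hΓ ⟨g₀, hg₀⟩ => ?_⟩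
  have : Nonempty G := ⟨g₀⟩
  have hsample : ∀ (g : G) i, |g.1 (p i)| ≤ b * n := by
    intro g i
    have h1 := abs_le_of_lipschitz (hG g g.2) (p i) 0
    rw [sub_zero] at h1
    have h2 := (abs_sub_abs_le_abs_sub (g.1 (p i)) (g.1 0)).trans h1
    have h3 := mul_le_mul_of_nonneg_left (hpn i) Lg.2
    have h4 := hG₀ g g.2
    have h5 : (c₀ + Lg * d₁) * n ≤ b * n := by gcongr
    have h6 : c₀ ≤ c₀ * n := le_mul_of_one_le_right hc₀ hn'
    simp only [NNReal.val_eq_coe] at h3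
    linarith
  -- The coordinatewise tolerance `1 / (n * M)` adds up over `M` samples to `ℓ¹` distance `1 / n`,
  -- as `sum_bumpWeight` requires; `J` is the resulting number of cells per coordinate.
  obtain ⟨r, hr⟩ := exists_cover (J := J) (fun (g : G) i => g.1 (p i)) (b := b * n)
    (δ := 1 / (n * M)) (by positivity) hsample (by
      rw [hJ, div_div_eq_mul_div, div_one]
      push_cast
      linarith [show (2 : ℝ) * (b * n) * (n * M) = 2 * b * n ^ 2 * M by ring])
  let s : Fin (J ^ M) → Fin M → ℝ := fun j i => (r j).1 (p i)
  let F : Fin (J ^ M) → EuclideanSpace ℝ (Fin d₂) → ℝ := fun j => (Γ (r j)).1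
  have hX4 := hX.moment 4 (by norm_num)
  have hgrow : ∀ g g' : G, s2Norm P X (g.1 - g'.1) ≤
      ENNReal.ofReal ((2 * c₀ + 2 * Lg) * (2 * (1 + |MX 4|))) := fun g g' =>
    s2Norm_le_of_growth (by positivity) hX4 fun z => by
      have h1 := abs_sub_le_growth (hG g g.2) (hG g' g'.2) (hG₀ g g.2) (hG₀ g' g'.2) z
      refine h1.trans ?_
      have hL : (0 : ℝ) ≤ Lg := Lg.2
      nlinarith [mul_nonneg hc₀ (sq_nonneg ‖z‖), mul_nonneg hL (sq_nonneg (‖z‖ - 1)),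
        mul_nonneg hL (sq_nonneg ‖z‖)]
  have hmul : ∀ c : ℝ, (LΓ : ℝ≥0∞) * ENNReal.ofReal c = ENNReal.ofReal (LΓ * c) := fun c => by
    rw [ENNReal.ofReal_mul LΓ.coe_nonneg]
    simp
  have hzero : ∀ g : G, |(Γ g).1 0| ≤
      B + LΓ * ((2 * c₀ + 2 * Lg) * (2 * (1 + |MX 4|))) + Lu * (1 + |MY 1|) := by
    intro g
    refine abs_apply_zero_le hT (by positivity) (hY.moment 1 one_pos) (hU _ (Γ g).2) ?_
    calc expect P (fun ω => ⨆ t, ENNReal.ofReal |(Γ g).1 (Y t ω)|)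
        ≤ expect P (fun ω => (⨆ t, ENNReal.ofReal |(Γ g₀).1 (Y t ω)|) +
            ⨆ t, ENNReal.ofReal |((Γ g).1 - (Γ g₀).1) (Y t ω)|) := by
          refine expect_mono fun ω => iSup_le fun t => ?_
          refine le_trans ?_ (add_le_add
            (le_iSup (fun t => ENNReal.ofReal |(Γ g₀).1 (Y t ω)|) t)
            (le_iSup (fun t => ENNReal.ofReal |((Γ g).1 - (Γ g₀).1) (Y t ω)|) t))
          rw [← ENNReal.ofReal_add (abs_nonneg _) (abs_nonneg _)]
          refine ENNReal.ofReal_le_ofReal ?_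
          have := abs_add_le ((Γ g₀).1 (Y t ω)) (((Γ g).1 - (Γ g₀).1) (Y t ω))
          simpa using this
      _ ≤ B + LΓ * ENNReal.ofReal ((2 * c₀ + 2 * Lg) * (2 * (1 + |MX 4|))) := by
          refine (expect_add_le _ _).trans (add_le_add
            ((expect_iSup_abs_le_s2Norm _).trans hg₀) ?_)
          exact (expect_iSup_abs_le_s2Norm _).trans ((hΓ g g₀).trans
            (mul_le_mul_right (hgrow g g₀) _))
      _ = _ := by
          rw [hmul, ENNReal.ofReal_add B.coe_nonneg (by positivity)]
          simp
  have hFt : ∀ j k, |F j (t k)| ≤ κ := by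
    intro j k
    have h1 := abs_le_of_lipschitz (hU _ (Γ (r j)).2) (t k) 0
    rw [sub_zero] at h1
    have h2 := (abs_sub_abs_le_abs_sub (F j (t k)) (F j 0)).trans h1
    have h3 := mul_le_mul_of_nonneg_left (ht k) Lu.2
    have h4 := hzero (r j)
    have h5 : B + LΓ * ((2 * c₀ + 2 * Lg) * (2 * (1 + |MX 4|))) + Lu * (1 + |MY 1|) ≤
      (B + LΓ * ((2 * c₀ + 2 * Lg) * (2 * (1 + |MX 4|))) + Lu * (1 + |MY 1|)) * n :=
      le_mul_of_one_le_right (by positivity) hn'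
    have h6 : (0 : ℝ) ≤ (b + 2) * n := by positivity
    simp only [NNReal.val_eq_coe] at h3
    refine le_trans ?_ hκ
    change |F j 0| ≤ _ at h4
    linarith
  have hrest : (0 : ℝ) ≤ B + LΓ * ((2 * c₀ + 2 * Lg) * (2 * (1 + |MX 4|))) + Lu * (1 + |MY 1|) +
      Lu * d₂ := by positivity
  have hbκ : ((b : ℝ) + 2) * n ≤ κ :=
    le_trans (mul_le_mul_of_nonneg_right (by linarith) hn0.le) hκ
  have hb0 : (0 : ℝ) ≤ b * n := by positivity
  refine ⟨fun k v => ∑ j, F j (t k) * bumpWeight n s (fun i => v (pos i)) j, fun k =>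
    sum_mul_bumpWeight_mem_FNN pos hM1 (by nlinarith)
      (by rw [abs_of_pos hn0]; nlinarith) (fun j i => (hsample (r j) i).trans (by linarith)) _
      fun j => hFt j k, iSup_le fun g => ?_⟩
  let v : Fin M → ℝ := fun i => g.1 (p i)
  have hv : (fun i => g.1 (p (finProdFinEquiv.symm (pos i)).2)) = v := by
    funext i
    simp [pos, v]
  have hsum : ∑ j, bumpWeight n s v j = 1 := by
    obtain ⟨j, hj⟩ := hr g
    refine sum_bumpWeight (j := j) ?_
    calc (n : ℝ) * ∑ i, |v i - s j i| ≤ n * ∑ _i : Fin M, 1 / (n * M : ℝ) := by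
          gcongr with i
          exact hj i
      _ = 1 := by
          simp only [Finset.sum_const, Finset.card_univ, Fintype.card_fin, nsmul_eq_mul]
          field_simp
  have hmain := expect_convex_combination_le (P := P) (Y := Y) (u := (Γ g).1) (v := F)
    (w := fun j z => ∑ k, F j (t k) * q k z) (ψ := bumpWeight n s v)
    (δ := LΓ * ((2 * c₀ + 2 * Lg + 2 * Lg * d₁ + 2) / n * (2 * (1 + |MX 4|))))
    (c := 4 * d₂ * Lu / n) (by positivity) (by positivity) (hY.moment 2 two_pos)
    (fun j => bumpWeight_nonneg j) hsum
    (fun j hj => by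
      refine (expect_iSup_abs_le_s2Norm ((Γ g).1 - (Γ (r j)).1)).trans ((hΓ _ _).trans ?_)
      rw [← hmul]
      refine mul_le_mul_right (s2Norm_le_of_growth (by positivity) hX4 fun z => ?_) _
      exact abs_sub_le_of_close_on_grid hn hp hc₀ (hG g g.2) (hG _ (r j).2) (hG₀ g g.2)
        (hG₀ _ (r j).2) (fun i => mul_abs_sub_le_of_bumpWeight_ne_zero hn0.le hj i) z)
    (fun j z => (abs_sub_sum_mul_le (fun k => hq0 k z) (hq1 z) (fun k hk => hqt k z hk)
      (hU _ (Γ (r j)).2)).trans (le_of_eq (by ring)))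
  refine le_trans (le_of_eq ?_) (hmain.trans (ENNReal.ofReal_le_ofReal (le_of_eq (by ring))))
  congr 1
  funext ω
  congr 1
  funext τ
  congr 3
  simp only [hv, Finset.sum_mul, Finset.mul_sum]
  rw [Finset.sum_comm]
  exact Finset.sum_congr rfl fun j _ => Finset.sum_congr rfl fun k _ => by ring

end Operator

end

/-! ### Comparison of the network sizes with the allowed bounds. -/

section Sizes

theorem inv_pow_le_rpow {e x : ℝ} (h0 : 0 < e) (h1 : e ≤ 1) (k : ℕ) (hx : x ≤ -(k : ℝ)) :
    e⁻¹ ^ k ≤ e ^ x := by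
  rw [inv_pow, ← Real.rpow_natCast, ← Real.rpow_neg h0.le]
  exact Real.rpow_le_rpow_of_exponent_ge h0 h1 hx

/-- Since `2 * log 2 > 1`, the cap at `1 / 2` keeps all logarithmic factors at least `1`, so they
can absorb constants. -/
theorem one_le_log_rpow {e x : ℝ} (h0 : 0 < e) (h1 : e ≤ 1 / 2) (hx : x ≤ -2) :
    1 ≤ Real.log (e ^ x) := by
  rw [Real.log_rpow h0]
  have h2 : Real.log e ≤ -Real.log 2 := by
    rw [← Real.log_inv]
    exact Real.log_le_log h0 (by linarith)
  have h3 := Real.log_two_gt_d9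
  nlinarith

theorem branch_nnz_le {K M A : ℕ} (hK : 1 ≤ K) (hM : 1 ≤ M) :
    2 * K * M * (A * M + 1) + K * (2 * K * M + 1) + 2 * K * (K + 1) + (2 * K + 1) ≤
      (2 * A + 12) * (K * M) ^ 2 := by
  have h1 : 1 ≤ K * M := Nat.mul_pos hK hM
  have h2 : K ≤ K * M := Nat.le_mul_of_pos_right K hM
  have h3 : M ≤ K * M := Nat.le_mul_of_pos_left M hK
  calc 2 * K * M * (A * M + 1) + K * (2 * K * M + 1) + 2 * K * (K + 1) + (2 * K + 1)
      = 2 * (K * M) * (A * M + 1) + K * (2 * (K * M) + 1) + 2 * K * (K + 1) + (2 * K + 1) := by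
        ring
    _ ≤ 2 * (K * M) * (A * (K * M) + K * M) + (K * M) * (2 * (K * M) + K * M) +
        2 * (K * M) * (K * M + K * M) + (2 * (K * M) * (K * M) + (K * M) * (K * M)) := by
        gcongr
        · nlinarith
        · nlinarith
    _ = (2 * A + 12) * (K * M) ^ 2 := by ring

/-- All network sizes are at most exponential in the number `M` of sample points. -/
theorem exists_exponent (d₁ b : ℕ) (C₂ : ℝ) : ∃ A : ℕ, 1 ≤ A ∧ ∀ (E : ℝ) (n M J K : ℕ), 2 ≤ E →
    1 ≤ n → n ≤ C₂ * E → M = (2 * n ^ 2 + 1) ^ d₁ → J = 2 * b * n ^ 2 * M + 1 → K = J ^ M →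
    (M : ℝ) ≤ (3 * n ^ 2) ^ d₁ ∧ 1 ≤ M ∧ 1 ≤ K ∧
      ((K * M : ℕ) : ℝ) ^ 2 ≤ E ^ (A * M) ∧ (n : ℝ) ≤ E ^ (A * M) := by
  -- As `2 ≤ E`, constants are absorbed into powers of `E`: `n ≤ E ^ (a + 1)`, `M ≤ E ^ a₂`, `J ≤ E
  -- ^ a₃`. In `A`, the first summand serves `(K * M) ^ 2` and the second serves `n`.
  obtain ⟨a, ha⟩ := pow_unbounded_of_one_lt C₂ one_lt_two
  obtain ⟨β, hβ⟩ := pow_unbounded_of_one_lt (2 * b + 1 : ℝ) one_lt_two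
  obtain ⟨a₂, ha₂_def⟩ : ∃ a₂ : ℕ, a₂ = (2 * a + 4) * d₁ := ⟨_, rfl⟩
  obtain ⟨a₃, ha₃_def⟩ : ∃ a₃ : ℕ, a₃ = β + (2 * a + 2) + a₂ := ⟨_, rfl⟩
  obtain ⟨A, hA_def⟩ : ∃ A : ℕ, A = 2 * (a₃ + a₂) + (a + 1) := ⟨_, rfl⟩
  have hA : 1 ≤ A := by omega
  refine ⟨A, hA, fun E n M J K hE2 hn hnle hM_def hJ_def hK_def => ?_⟩
  have hE1 : 1 ≤ E := by linarith
  have hn' : (1 : ℝ) ≤ n := by exact_mod_cast hn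
  have htwo : ∀ k : ℕ, (2 : ℝ) ^ k ≤ E ^ k := fun k => by gcongr
  have hnE : (n : ℝ) ≤ E ^ (a + 1) := by
    rw [pow_succ]
    exact hnle.trans (mul_le_mul_of_nonneg_right (ha.le.trans (htwo a)) (by linarith))
  have hM3 : (M : ℝ) ≤ (3 * n ^ 2) ^ d₁ := by
    rw [hM_def]
    push_cast
    gcongr
    nlinarith
  have hM1 : 1 ≤ M := hM_def ▸ Nat.one_le_pow _ _ (by omega)
  have hMr : (1 : ℝ) ≤ M := by exact_mod_cast hM1
  have hME : (M : ℝ) ≤ E ^ a₂ := by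
    refine hM3.trans ?_
    rw [ha₂_def, pow_mul]
    gcongr
    calc (3 : ℝ) * n ^ 2 ≤ E ^ 2 * (E ^ (a + 1)) ^ 2 := by
          gcongr
          nlinarith
      _ = E ^ (2 * a + 4) := by ring
  have hJE : (J : ℝ) ≤ E ^ a₃ := by
    calc (J : ℝ) = 2 * b * (n ^ 2 * M) + 1 := by rw [hJ_def]; push_cast; ring
      _ ≤ (2 * b + 1) * (n ^ 2 * M) := by
          have : (1 : ℝ) ≤ n ^ 2 * M := one_le_mul_of_one_le_of_one_le (one_le_pow₀ hn') hMr
          linarith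
      _ ≤ E ^ β * ((E ^ (a + 1)) ^ 2 * E ^ a₂) := by
          gcongr
          exact hβ.le.trans (htwo β)
      _ = E ^ a₃ := by rw [ha₃_def]; ring
  have hK1 : 1 ≤ K := hK_def ▸ Nat.one_le_pow _ _ (hJ_def ▸ Nat.succ_pos _)
  have hKM : ((K * M : ℕ) : ℝ) ≤ E ^ ((a₃ + a₂) * M) := by
    calc ((K * M : ℕ) : ℝ) = (J : ℝ) ^ M * M := by rw [hK_def]; push_cast; ring
      _ ≤ (E ^ a₃) ^ M * (E ^ a₂) ^ M := by
          gcongr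
          exact hME.trans (le_self_pow₀ (one_le_pow₀ hE1) (by omega))
      _ = E ^ ((a₃ + a₂) * M) := by ring
  have hKM1 : (1 : ℝ) ≤ ((K * M : ℕ) : ℝ) := by exact_mod_cast Nat.mul_pos hK1 hM1
  have hKM2 : ((K * M : ℕ) : ℝ) ^ 2 ≤ E ^ (A * M) := by
    calc ((K * M : ℕ) : ℝ) ^ 2 ≤ (E ^ ((a₃ + a₂) * M)) ^ 2 := by gcongr
      _ = E ^ (2 * (a₃ + a₂) * M) := by ring
      _ ≤ E ^ (A * M) := by
          gcongr
          omega
  have hnA : (n : ℝ) ≤ E ^ (A * M) := by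
    refine hnE.trans ?_
    gcongr
    calc a + 1 ≤ A := by omega
      _ ≤ A * M := Nat.le_mul_of_pos_right A hM1
  exact ⟨hM3, hM1, hK1, hKM2, hnA⟩

/-- The choice of the scale `1 / n`, and the bounds of all network sizes. -/
theorem exists_sizes {d₁ d₂ : ℕ} (hd₂ : 1 ≤ d₂) (L₁ w₁ s₁ b : ℕ) {C₁ C₃ : ℝ}
    (hC₁ : 1 ≤ C₁) (hC₃ : 0 ≤ C₃) : ∃ (A : ℕ) (C : ℝ), 1 ≤ A ∧ 0 < C ∧ ∀ e : ℝ, 0 < e → e ≤ 1 / 2 →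
    ∃ n M J K N₂ : ℕ, 1 ≤ n ∧ C₁ ≤ e * n ∧ M = (2 * n ^ 2 + 1) ^ d₁ ∧
      J = 2 * b * n ^ 2 * M + 1 ∧ K = J ^ M ∧ N₂ = A * M ∧
      (((2 * n + 1) ^ d₂ : ℕ) : ℝ) ≤ C * e ^ (-(d₂ : ℝ)) ∧
      (N₂ : ℝ) ≤ C * e ^ (-(d₁ * d₂ : ℝ) - d₁) ∧
      (L₁ : ℝ) ≤ C * Real.log (e ^ (-2 : ℝ)) ∧
      (w₁ : ℝ) ≤ C ∧
      (s₁ : ℝ) ≤ C * Real.log (e ^ (-2 : ℝ)) ∧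
      (n : ℝ) + 1 ≤ C * e ^ (-(d₂ : ℝ)) ∧
      ((4 : ℕ) : ℝ) ≤ C * ((N₂ : ℝ) ^ 2 * Real.log N₂
        + (N₂ : ℝ) ^ 2 * Real.log (e ^ (-(d₂ : ℝ) - 1))) ∧
      ((2 * K * M : ℕ) : ℝ) ≤ C * ((N₂ : ℝ) ^ (1 / 2 : ℝ) * e ^ (-(N₂ * d₂ : ℝ) - N₂)) ∧
      ((2 * K * M * (N₂ + 1) + K * (2 * K * M + 1) + 2 * K * (K + 1) + (2 * K + 1) : ℕ) : ℝ) ≤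
        C * ((N₂ : ℝ) ^ (1 / 2 : ℝ) * e ^ (-(N₂ * d₂ : ℝ) - N₂)
          * ((N₂ : ℝ) ^ 2 * Real.log N₂
            + (N₂ : ℝ) ^ 2 * Real.log (e ^ (-(d₂ : ℝ) - 1)))) ∧
      C₃ * n ≤ C * ((N₂ : ℝ) ^ ((N₂ : ℝ) / 2) * e ^ (-(N₂ * d₂ : ℝ) / 2 - N₂)) := by
  obtain ⟨C₂, hC₂_def⟩ : ∃ C₂ : ℝ, C₂ = C₁ + 1 := ⟨_, rfl⟩
  have hC₂ : 0 ≤ C₂ := by linarith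
  obtain ⟨A, hA, hexp⟩ := exists_exponent d₁ b C₂
  obtain ⟨C, hC0, hCN₁, hCN₂, hCL₁, hCw₁, hCs₁, hCκ₁, hC4, hCA, hCC₃⟩ : ∃ C : ℝ, 0 < C ∧
      (3 * C₂) ^ d₂ ≤ C ∧ A * (3 * C₂ ^ 2) ^ d₁ ≤ C ∧ L₁ ≤ C ∧ w₁ ≤ C ∧ s₁ ≤ C ∧ C₂ + 1 ≤ C ∧
      4 ≤ C ∧ 2 * A + 12 ≤ C ∧ C₃ ≤ C := by
    have p1 : (0 : ℝ) ≤ (3 * C₂) ^ d₂ := by positivity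
    have p2 : (0 : ℝ) ≤ A * (3 * C₂ ^ 2) ^ d₁ := by positivity
    have p3 : (0 : ℝ) ≤ L₁ := by positivity
    have p4 : (0 : ℝ) ≤ w₁ := by positivity
    have p5 : (0 : ℝ) ≤ s₁ := by positivity
    have p6 : (0 : ℝ) ≤ A := by positivity
    refine ⟨(3 * C₂) ^ d₂ + A * (3 * C₂ ^ 2) ^ d₁ + L₁ + w₁ + s₁ + (C₂ + 1) + 4 + (2 * A + 12) +
      C₃, ?_, ?_, ?_, ?_, ?_, ?_, ?_, ?_, ?_, ?_⟩ <;> linarith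
  refine ⟨A, C, hA, hC0, fun e he0 heh => ?_⟩
  have he1 : e ≤ 1 := by linarith
  set E : ℝ := e⁻¹ with hE
  have hE2 : 2 ≤ E := by rw [hE, le_inv_comm₀ two_pos he0]; linarith
  have hE1 : 1 ≤ E := by linarith
  obtain ⟨n, hn_def⟩ : ∃ n : ℕ, n = ⌈C₁ * E⌉₊ := ⟨_, rfl⟩
  have hnge : C₁ * E ≤ n := hn_def ▸ Nat.le_ceil _
  have hn : 1 ≤ n := hn_def ▸ Nat.one_le_ceil_iff.2 (by positivity)
  have hn' : (1 : ℝ) ≤ n := by exact_mod_cast hn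
  have hnle : (n : ℝ) ≤ C₂ * E := by
    have := (Nat.ceil_lt_add_one (show 0 ≤ C₁ * E by positivity)).le
    rw [← hn_def] at this
    rw [hC₂_def, add_mul]
    linarith
  obtain ⟨M, hM_def⟩ : ∃ M : ℕ, M = (2 * n ^ 2 + 1) ^ d₁ := ⟨_, rfl⟩
  obtain ⟨J, hJ_def⟩ : ∃ J : ℕ, J = 2 * b * n ^ 2 * M + 1 := ⟨_, rfl⟩
  obtain ⟨K, hK_def⟩ : ∃ K : ℕ, K = J ^ M := ⟨_, rfl⟩
  obtain ⟨N₂, hN₂_def⟩ : ∃ N₂ : ℕ, N₂ = A * M := ⟨_, rfl⟩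
  obtain ⟨hM3, hM1, hK1, hKM2, hnA⟩ := hexp E n M J K hE2 hn hnle hM_def hJ_def hK_def
  have hKM1 : (1 : ℝ) ≤ ((K * M : ℕ) : ℝ) := by exact_mod_cast Nat.mul_pos hK1 hM1
  rw [← hN₂_def] at hKM2 hnA
  have hN1 : (1 : ℝ) ≤ (N₂ : ℝ) := by
    rw [hN₂_def]
    exact_mod_cast Nat.mul_pos hA hM1
  have hlog : 1 ≤ (N₂ : ℝ) ^ 2 * Real.log (N₂ : ℝ) +
      (N₂ : ℝ) ^ 2 * Real.log (e ^ (-(d₂ : ℝ) - 1)) := by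
    have hd : (1 : ℝ) ≤ d₂ := by exact_mod_cast hd₂
    have h1 := one_le_log_rpow he0 heh (x := -(d₂ : ℝ) - 1) (by linarith)
    have h2 := one_le_mul_of_one_le_of_one_le (one_le_pow₀ hN1 (n := 2)) h1
    have h3 := mul_nonneg (sq_nonneg (N₂ : ℝ)) (Real.log_nonneg hN1)
    linarith
  have hlog2 : 1 ≤ Real.log (e ^ (-2 : ℝ)) := one_le_log_rpow he0 heh le_rfl
  have hw : E ^ N₂ ≤ (N₂ : ℝ) ^ (1 / 2 : ℝ) *
      e ^ (-((N₂ : ℝ) * d₂) - (N₂ : ℝ)) := by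
    refine (inv_pow_le_rpow he0 he1 N₂ ?_).trans (le_mul_of_one_le_left (by positivity)
      (Real.one_le_rpow hN1 (by norm_num)))
    have : (0 : ℝ) ≤ (N₂ : ℝ) * d₂ := by positivity
    linarith
  have hκ₂ : E ^ N₂ ≤ (N₂ : ℝ) ^ ((N₂ : ℝ) / 2) *
      e ^ (-((N₂ : ℝ) * d₂) / 2 - (N₂ : ℝ)) := by
    refine (inv_pow_le_rpow he0 he1 N₂ ?_).trans (le_mul_of_one_le_left (by positivity)
      (Real.one_le_rpow hN1 (by positivity)))
    have : (0 : ℝ) ≤ (N₂ : ℝ) * d₂ := by positivity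
    linarith
  have hEd : E ^ d₂ ≤ e ^ (-(d₂ : ℝ)) := inv_pow_le_rpow he0 he1 d₂ le_rfl
  have key : ∀ {c u v : ℝ}, u ≤ c * v → 0 ≤ v → c ≤ C → u ≤ C * v :=
    fun h hv hc => h.trans (mul_le_mul_of_nonneg_right hc hv)
  have hCe : C₁ ≤ e * n := by
    calc C₁ = e * (C₁ * E) := by rw [hE]; field_simp
      _ ≤ e * n := by gcongr
  refine ⟨n, M, J, K, N₂, hn, hCe, hM_def, hJ_def, hK_def, hN₂_def,
    key ?_ (by positivity) hCN₁, key ?_ (by positivity) hCN₂,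
    key (le_mul_of_one_le_right (Nat.cast_nonneg _) hlog2) (zero_le_one.trans hlog2) hCL₁, hCw₁,
    key (le_mul_of_one_le_right (Nat.cast_nonneg _) hlog2) (zero_le_one.trans hlog2) hCs₁,
    key ?_ (by positivity) hCκ₁,
    key (c := 4) ?_ (zero_le_one.trans hlog) hC4,
    key (c := 2) ?_ (by positivity) ((by norm_num : (2 : ℝ) ≤ 4).trans hC4),
    key ?_ (mul_nonneg (by positivity) (zero_le_one.trans hlog)) hCA,
    key (mul_le_mul_of_nonneg_left (hnA.trans hκ₂) hC₃) (by positivity) hCC₃⟩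
  · calc (((2 * n + 1) ^ d₂ : ℕ) : ℝ) ≤ (3 * (C₂ * E)) ^ d₂ := by
          push_cast
          gcongr
          linarith
      _ = (3 * C₂) ^ d₂ * E ^ d₂ := by rw [← mul_assoc, mul_pow]
      _ ≤ _ := by gcongr
  -- The grid has order `n ^ (2 * d₁)` points, within the allowed exponent because `2 * d₁ ≤ d₁ * d₂
  -- + d₁` for `d₂ ≥ 1`.
  · have h1 : E ^ (2 * d₁) ≤ e ^ (-(d₁ * d₂ : ℝ) - d₁) := by
      refine inv_pow_le_rpow he0 he1 (2 * d₁) ?_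
      push_cast
      have : (d₁ : ℝ) * 1 ≤ d₁ * d₂ := by gcongr; exact_mod_cast hd₂
      linarith
    calc (N₂ : ℝ) ≤ A * (3 * (C₂ * E) ^ 2) ^ d₁ := by
          rw [hN₂_def]
          push_cast
          gcongr
          exact hM3.trans (by gcongr)
      _ = A * (3 * C₂ ^ 2) ^ d₁ * E ^ (2 * d₁) := by
          rw [pow_mul, mul_assoc, ← mul_pow]
          ring
      _ ≤ _ := by gcongr
  · calc (n : ℝ) + 1 ≤ (C₂ + 1) * E ^ 1 := by rw [pow_one]; linarith
      _ ≤ (C₂ + 1) * E ^ d₂ := by gcongr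
      _ ≤ _ := by gcongr
  · rw [Nat.cast_ofNat]
    exact le_mul_of_one_le_right (by norm_num) hlog
  · calc ((2 * K * M : ℕ) : ℝ) = 2 * ((K * M : ℕ) : ℝ) := by push_cast; ring
      _ ≤ 2 * ((K * M : ℕ) : ℝ) ^ 2 := by gcongr; exact le_self_pow₀ hKM1 two_ne_zero
      _ ≤ _ := by gcongr; exact hKM2.trans hw
  · rw [hN₂_def] at hKM2 hw hlog ⊢
    refine (Nat.cast_le (α := ℝ).2 (branch_nnz_le (A := A) hK1 hM1)).trans ?_
    calc (((2 * A + 12) * (K * M) ^ 2 : ℕ) : ℝ) = (2 * A + 12) * ((K * M : ℕ) : ℝ) ^ 2 := by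
          push_cast; ring
      _ ≤ _ := by
          gcongr
          exact (hKM2.trans hw).trans (le_mul_of_one_le_right (by positivity) hlog)

end Sizes

/-! ### The operator approximation theorem. -/

theorem mainTheorem1
    (d₁ d₂ : ℕ) (hd₁ : 1 ≤ d₁) (hd₂ : 1 ≤ d₂)
    -- growth and Lipschitz constants
    (p Cg : ℝ) (hp : 0 < p) (Lg Lu LΓ B : ℝ≥0)
    -- moment and tail constants of the two processes
    (MX MY : ℝ → ℝ) (cX CX αX cY CY αY : ℝ)
    (hcX : 0 < cX) (hCX : 0 < CX) (hαX : 0 < αX) (hcY : 0 < cY) (hCY : 0 < CY) (hαY : 0 < αY) :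
    ∃ C : ℝ, 0 < C ∧
      ∀ (T : ℝ) (hT : 0 ≤ T) (Ω : Type*) [m : MeasurableSpace Ω] (P : Measure Ω)
        [IsProbabilityMeasure P] (ℱ : Filtration (Icc (0 : ℝ) T) m)
        (_ : UsualConditions hT P ℱ)
        (X : Icc (0 : ℝ) T → Ω → EuclideanSpace ℝ (Fin d₁)) (x : EuclideanSpace ℝ (Fin d₁))
        (Y : Icc (0 : ℝ) T → Ω → EuclideanSpace ℝ (Fin d₂)) (y : EuclideanSpace ℝ (Fin d₂))
        (_ : IsModelProcess hT P ℱ X x MX cX CX αX)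
        (_ : IsModelProcess hT P ℱ Y y MY cY CY αY)
        -- the input class
        (G : Set (EuclideanSpace ℝ (Fin d₁) → ℝ)) (_ : G ⊆ S2Space P ℱ X)
        (_ : ∀ g ∈ G, ∀ z, |g z| ≤ Cg * (1 + ‖z‖ ^ p))
        (_ : ∀ g ∈ G, LipschitzWith Lg g)
        -- the output class
        (U : Set (EuclideanSpace ℝ (Fin d₂) → ℝ)) (_ : U ⊆ S2Space P ℱ Y)
        (_ : ∀ u ∈ U, LipschitzWith Lu u)
        (ε e : ℝ) (_ : 0 < ε) (_ : e = min ε (1 / 2)),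
      ∃ (N₁ N₂ ℒ₁ 𝔭₁ K₁ ℒ₂ 𝔭₂ K₂ : ℕ) (κ₁ κ₂ : ℝ),
        ((N₁ : ℝ) ≤ C * e ^ (-(d₂ : ℝ)) ∧
          (N₂ : ℝ) ≤ C * e ^ (-(d₁ * d₂ : ℝ) - d₁) ∧
          (ℒ₁ : ℝ) ≤ C * Real.log (e ^ (-2 : ℝ)) ∧
          (𝔭₁ : ℝ) ≤ C ∧
          (K₁ : ℝ) ≤ C * Real.log (e ^ (-2 : ℝ)) ∧
          κ₁ ≤ C * e ^ (-(d₂ : ℝ)) ∧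
          (ℒ₂ : ℝ) ≤ C * ((N₂ : ℝ) ^ 2 * Real.log N₂
            + (N₂ : ℝ) ^ 2 * Real.log (e ^ (-(d₂ : ℝ) - 1))) ∧
          (𝔭₂ : ℝ) ≤ C * ((N₂ : ℝ) ^ (1 / 2 : ℝ) * e ^ (-(N₂ * d₂ : ℝ) - N₂)) ∧
          (K₂ : ℝ) ≤ C * ((N₂ : ℝ) ^ (1 / 2 : ℝ) * e ^ (-(N₂ * d₂ : ℝ) - N₂)
            * ((N₂ : ℝ) ^ 2 * Real.log N₂
              + (N₂ : ℝ) ^ 2 * Real.log (e ^ (-(d₂ : ℝ) - 1)))) ∧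
          κ₂ ≤ C * ((N₂ : ℝ) ^ ((N₂ : ℝ) / 2) * e ^ (-(N₂ * d₂ : ℝ) / 2 - N₂))) ∧
        -- the sampling points
        ∃ c : Fin N₂ → EuclideanSpace ℝ (Fin d₁),
          ∀ Γ : G → U,
            (∀ g₁ g₂ : G, s2Norm P Y ((Γ g₁).1 - (Γ g₂).1) ≤ LΓ * s2Norm P X (g₁.1 - g₂.1)) →
            -- `B` is any bound for one output; it only enters the choice of `C`
            (∃ g₀ : G, s2Norm P Y (Γ g₀).1 ≤ B) →
            ∃ (q : Fin N₁ → (Fin d₂ → ℝ) → ℝ) (a : Fin N₁ → (Fin N₂ → ℝ) → ℝ),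
              (∀ k, q k ∈ FNN d₂ ℒ₁ 𝔭₁ K₁ κ₁ 1) ∧
              (∀ k, a k ∈ FNN N₂ ℒ₂ 𝔭₂ K₂ κ₂ ⊤) ∧
              ⨆ g : G, expect P (fun ω => ⨆ t, ENNReal.ofReal
                |(Γ g).1 (Y t ω) - ∑ k, a k (fun n => g.1 (c n)) * q k (Y t ω)|)
                ≤ ENNReal.ofReal ε := by
  obtain ⟨L₁, w₁, s₁, htrunk⟩ := exists_trunk d₂ hd₂
  -- `C₁ / n` dominates the error of `exists_branch`; the added `1` ensures `1 ≤ C₁`. Below, `C₃ *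
  -- n` bounds the branch parameters.
  obtain ⟨C₁, hC₁_def⟩ : ∃ C₁ : ℝ, C₁ = LΓ * ((2 * |Cg| + 2 * Lg + 2 * Lg * d₁ + 2) *
    (2 * (1 + |MX 4|))) + 4 * d₂ * Lu * (1 + |MY 2|) + 1 := ⟨_, rfl⟩
  have hC₁ : 1 ≤ C₁ := by rw [hC₁_def]; exact le_add_of_nonneg_left (by positivity)
  obtain ⟨b, hb_def⟩ : ∃ b : ℕ, b = ⌈|Cg| + Lg * d₁⌉₊ := ⟨_, rfl⟩
  obtain ⟨C₃, hC₃_def⟩ : ∃ C₃ : ℝ, C₃ = b + 2 + (B + LΓ * ((2 * |Cg| + 2 * Lg) *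
    (2 * (1 + |MX 4|))) + Lu * (1 + |MY 1|)) + Lu * d₂ := ⟨_, rfl⟩
  have hC₃ : 0 ≤ C₃ := by rw [hC₃_def]; positivity
  obtain ⟨A, C, hA, hC0, hsizes⟩ := exists_sizes (d₁ := d₁) hd₂ L₁ w₁ s₁ b hC₁ hC₃
  refine ⟨C, hC0, ?_⟩
  intro T hT Ω m P _ ℱ _ X x Y y hX hY G _ hGg hGL U _ hUL ε e hε he
  have he0 : 0 < e := by rw [he]; positivity
  have heh : e ≤ 1 / 2 := by rw [he]; exact min_le_right _ _
  have heε : e ≤ ε := by rw [he]; exact min_le_left _ _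
  obtain ⟨n, M, J, K, N₂, hn, hCe, hM_def, hJ_def, hK_def, rfl, hbounds⟩ := hsizes e he0 heh
  have hn' : (0 : ℝ) < n := by exact_mod_cast hn
  obtain ⟨q, t, hq, hq0, hq1, ht, hqt⟩ := htrunk n hn
  refine ⟨(2 * n + 1) ^ d₂, A * M, L₁, w₁, s₁, 4, 2 * K * M, 2 * K * M * (A * M + 1) +
    K * (2 * K * M + 1) + 2 * K * (K + 1) + (2 * K + 1), n + 1, C₃ * n, hbounds, ?_⟩
  -- At `z = 0` the term `‖z‖ ^ p` vanishes because `p > 0`; with the Lipschitz bound this gives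
  -- uniform linear growth on `G`.
  have hG₀ : ∀ g ∈ G, |g 0| ≤ |Cg| := fun g hg => by
    have := hGg g hg 0
    rw [norm_zero, Real.zero_rpow hp.ne', add_zero, mul_one] at this
    exact this.trans (le_abs_self _)
  obtain ⟨c, hc⟩ := exists_branch hT hX hY (LΓ := LΓ) (B := B) hG₀ hGL hUL hn hA
    (b := b) (hb_def ▸ Nat.le_ceil _)
    (abs_nonneg _) hq0 hq1 ht hqt hM_def hJ_def
    (κ := C₃ * n) (by rw [hC₃_def])
  rw [← hK_def] at hc
  refine ⟨c, fun Γ hΓ hB => ?_⟩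
  obtain ⟨α, hα, herr⟩ := hc Γ hΓ hB
  refine ⟨q, α, hq, hα, herr.trans (ENNReal.ofReal_le_ofReal ?_)⟩
  refine le_trans ?_ heε
  rw [div_le_iff₀ hn']
  exact le_trans (by rw [hC₁_def]; linarith) hCe
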